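/- Let $(R,\mathfrak m)$ be a two-dimensional Cohen--Macaulay (Noetherian) local ring, $I$ an $\mathfrak m$-primary ideal, and $\mathcal I=\{I_n\}_{n\in\mathbb Z}$ an $I$-admissible filtration, i.e. a sequence of ideals with $I_{n+1}\subseteq I_n$, $I_mI_n\subseteq I_{m+n}$ for all $m,n$, and, for some $k\in\mathbb N$, $I^n\subseteq I_n\subseteq I^{n-k}$ for all $n$ (where $I^j=R$ for $j\le 0$). Let $\lambda$ denote length, and let $e_0,e_1,e_2\in\mathbb Z$ be the Hilbert coefficients of $\mathcal I$, i.e. the unique integers with $\lambda(R/I_n)=e_0\binom{n+1}{2}-e_1n+e_2$ for all $n\gg0$. Put $\widetilde{I_n}=\bigcup_{t\ge0}(I_{n+t}:I^t)$. A reduction of $\mathcal I$ is an ideal $J\subseteq I_1$ with $JI_n=I_{n+1}$ for $n\gg 0$; it is minimal if it is minimal under inclusion among all reductions of $\mathcal I$. Let $J\subseteq I$ be a minimal reduction of $\mathcal I$, and assume that the residue field $R/\mathfrak m$ is infinite or, more generally, that $J$ is generated by two elements. Put $\widetilde r_J(\mathcal I)=\sup\{n\in\mathbb Z : \widetilde{I_n}\ne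 J\widetilde{I_{n-1}}\}$. Then this supremum is finite, and $$\widetilde r_J(\mathcal I)\le e_2+1 .$$ Furthermore, consider the statements (i) $\widetilde r_J(\mathcal I)=e_2+1$; (ii) $\widetilde{I_{n+1}}=J\widetilde{I_n}$ for all integers $n\ge 1$ with $n\ne e_2$; (iii) $\lambda(\widetilde{I_{e_2+1}}/J\widetilde{I_{e_2}})=1$; (iv) $e_1=e_0-\lambda(R/\widetilde{I_1})+1$. Then (iv) $\Rightarrow$ (iii) $\Rightarrow$ (i) $\Rightarrow$ (ii); if $J\ne I$, then also (ii) $\Rightarrow$ (i); and if $e_2\ne0$, then all four statements are equivalent. -/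

import Mathlib

namespace FiltrationHilbert

variable {R : Type*} [CommRing R]

/-- A Noetherian local ring is Cohen–Macaulay if its maximal ideal contains a regular sequence
whose length is the Krull dimension of the ring. -/
def IsCohenMacaulayLocal (R : Type*) [CommRing R] [IsLocalRing R] : Prop :=
  IsNoetherianRing R ∧
    ∃ rs : List R, (∀ r ∈ rs, r ∈ IsLocalRing.maximalIdeal R) ∧
      RingTheory.Sequence.IsRegular R rs ∧ ringKrullDim R = (rs.length : WithBot ℕ∞)

/-- `I`-admissible filtrations `𝓘 = {I_n}_{n ∈ ℤ}`; the power `I ^ n` with `n ≤ 0` is the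
unit ideal. -/
structure IsAdmissible (I : Ideal R) (𝓘 : ℤ → Ideal R) : Prop where
  succ_le : ∀ n : ℤ, 𝓘 (n + 1) ≤ 𝓘 n
  mul_le : ∀ m n : ℤ, 𝓘 m * 𝓘 n ≤ 𝓘 (m + n)
  pow_le : ∀ n : ℤ, I ^ n.toNat ≤ 𝓘 n
  le_pow : ∃ k : ℕ, ∀ n : ℤ, 𝓘 n ≤ I ^ (n - k).toNat

/-- `J` is a reduction of `𝓘`: `J ⊆ I_1` and `J I_n = I_{n+1}` for all large `n`. -/
def IsReduction (𝓘 : ℤ → Ideal R) (J : Ideal R) : Prop :=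
  J ≤ 𝓘 1 ∧ ∀ᶠ n : ℤ in Filter.atTop, J * 𝓘 n = 𝓘 (n + 1)

/-- `J` is a minimal reduction of `𝓘`: it is minimal for inclusion among all reductions. -/
def IsMinimalReduction (𝓘 : ℤ → Ideal R) (J : Ideal R) : Prop :=
  Minimal (IsReduction 𝓘) J

/-- The Ratliff–Rush filtration `n ↦ ⋃_{t ≥ 0} (I_{n+t} : I^t)`. For an admissible filtration the
supremum is the union, see `mem_ratliffRush`. -/
def ratliffRush (I : Ideal R) (𝓘 : ℤ → Ideal R) (n : ℤ) : Ideal R :=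
  ⨆ t : ℕ, (𝓘 (n + t)).colon ((I ^ t : Ideal R) : Set R)

theorem mem_ratliffRush {I : Ideal R} {𝓘 : ℤ → Ideal R} (h : IsAdmissible I 𝓘) (n : ℤ) (a : R) :
    a ∈ ratliffRush I 𝓘 n ↔ ∃ t : ℕ, ∀ b ∈ I ^ t, a * b ∈ 𝓘 (n + t) := by
  have hmono : Monotone fun t : ℕ => (𝓘 (n + t)).colon ((I ^ t : Ideal R) : Set R) := by
    refine monotone_nat_of_le_succ fun t a ha => ?_
    rw [Submodule.mem_colon] at ha ⊢
    intro b hb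
    have hb' : b ∈ I * I ^ t := by rw [← pow_succ']; exact hb
    have hI : I ≤ 𝓘 1 := by simpa using h.pow_le 1
    refine Submodule.mul_induction_on hb' (fun x hx y hy => ?_) (fun x y hx hy => ?_)
    · have h1 : x * (a * y) ∈ 𝓘 (1 + (n + t)) :=
        h.mul_le _ _ (Ideal.mul_mem_mul (hI hx) (ha y hy))
      have e1 : a • (x * y) = x * (a * y) := by simp only [smul_eq_mul]; ring
      have e2 : n + ((t + 1 : ℕ) : ℤ) = 1 + (n + t) := by push_cast; ring
      rw [e1, e2]
      exact h1
    · rw [smul_add]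
      exact add_mem hx hy
  unfold ratliffRush
  rw [Submodule.mem_iSup_of_directed _ hmono.directed_le]
  simp only [Submodule.mem_colon, SetLike.mem_coe, smul_eq_mul]

/-- The set of `n ∈ ℤ` with `Ĩ_n ≠ J Ĩ_{n-1}`. -/
def rTildeSet (I J : Ideal R) (𝓘 : ℤ → Ideal R) : Set ℤ :=
  {n : ℤ | ratliffRush I 𝓘 n ≠ J * ratliffRush I 𝓘 (n - 1)}

/-- `r̃_J(𝓘) = sup {n ∈ ℤ | Ĩ_n ≠ J Ĩ_{n-1}}`. -/
noncomputable def rTilde (I J : Ideal R) (𝓘 : ℤ → Ideal R) : ℤ :=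
  sSup (rTildeSet I J 𝓘)

/-- The length `λ(R/𝔞)`, as an integer (used for ideals of finite colength only). -/
noncomputable def colength (𝔞 : Ideal R) : ℤ :=
  ((Module.length R (R ⧸ 𝔞)).toNat : ℤ)

/-- `e_0, …, e_d` are Hilbert coefficients of `𝓘` (`d` being the dimension of the ring):
`λ(R/I_n) = ∑_{i=0}^{d} (-1)^i e_i binom(n+d-1-i, d-i)` for all large `n`. -/
def IsHilbertCoeffs (d : ℕ) (𝓘 : ℤ → Ideal R) (e : Fin (d + 1) → ℤ) : Prop :=
  ∀ᶠ n : ℤ in Filter.atTop,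
    colength (𝓘 n) =
      ∑ i : Fin (d + 1), (-1) ^ (i : ℕ) * e i * Ring.choose (n + d - 1 - (i : ℕ)) (d - (i : ℕ))

open Classical in
/-- The Hilbert coefficients `e_i(𝓘)` of `𝓘` (with value `0` if there are none). -/
noncomputable def hilbertCoeff (d : ℕ) (𝓘 : ℤ → Ideal R) : Fin (d + 1) → ℤ :=
  if h : ∃ e, IsHilbertCoeffs d 𝓘 e then h.choose else 0

/-- The length `λ(𝔟/𝔞)` for ideals `𝔞 ⊆ 𝔟`. -/
noncomputable def relLength (𝔟 𝔞 : Ideal R) : ℕ∞ :=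
  Module.length R (𝔟 ⧸ 𝔞.submoduleOf 𝔟)

end FiltrationHilbert

/-!
The Ratliff–Rush filtration `Ĩ_n` agrees with `I_n` for large `n`, satisfies `(Ĩ_{n+1} : J) = Ĩ_n`
in *every* degree, and hence behaves as if `gr` had positive depth. Write `h n = λ(R/Ĩ_n)` and
`u n = λ(Ĩ_{n+1}/JĨ_n)`.

If `J = (x, y)`, then `x, y` have only Koszul relations, because `J` contains a regular sequence of
length two (`IsRegularPair.exists_koszul`), so that `0 → R/Ĩ_{n-1} → (R/Ĩ_n)² → J/JĨ_n → 0` is exact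
(`length_koszul`). Counting lengths gives Huneke's formula
`h (n+1) - 2 h n + h (n-1) = λ(R/J) - u n` (`colength_second_difference`). Since `u n = 0` for large
`n`, the Hilbert polynomial exists with `e₀ = λ(R/J)`, and summing the second differences down from
infinity (`hilbertCoeffs_eq_sum`) yields
`e₂ = ∑_{n ≥ 1} n · u n` and `e₁ - e₀ + λ(R/Ĩ_1) = ∑_{n ≥ 1} u n`.
The bound on `r̃` and the four conditions are statements about these two sums of natural numbers: a
nonzero `u n` contributes at least `n` to `e₂`.

That `Ĩ_n = I_n` for large `n` is derived from Artin–Rees without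
superficial elements (`IsReduction.exists_colon_le`), so that no assumption on the residue field is
needed. If the residue field is infinite, a minimal reduction is generated by two elements
(`IsMinimalReduction.exists_eq_span_pair`): the number of generators of `J ^ n` is bounded linearly
in `n` (`spanFinrank_le_one_add_length`, `length_quotient_sup_span_pow_le`), whereas three generators
that cannot be replaced by two would have too many independent monomials (`exists_two_of_three`).
-/

namespace FiltrationHilbert

open IsLocalRing

/-! ### Lengths of quotients of ideals -/

section Length

variable {R : Type*} [CommRing R]

theorem length_quotient_eq_relLength_add {𝔞 𝔟 : Ideal R} (h : 𝔞 ≤ 𝔟) :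
    Module.length R (R ⧸ 𝔞) = relLength 𝔟 𝔞 + Module.length R (R ⧸ 𝔟) := by
  refine Module.length_eq_add_of_exact
    ((𝔞.submoduleOf 𝔟).mapQ 𝔞 𝔟.subtype le_rfl) (Submodule.factor h) ?_
    (Submodule.factor_surjective h) ?_
  · rw [injective_iff_map_eq_zero]
    intro q hq
    obtain ⟨r, rfl⟩ := Submodule.mkQ_surjective _ q
    have hr : (r : R) ∈ 𝔞 := (Submodule.Quotient.mk_eq_zero 𝔞).1 hq
    exact (Submodule.Quotient.mk_eq_zero (𝔞.submoduleOf 𝔟)).2 hr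
  · intro q
    obtain ⟨r, rfl⟩ := Submodule.mkQ_surjective _ q
    constructor
    · intro hr
      have hr : r ∈ 𝔟 := (Submodule.Quotient.mk_eq_zero 𝔟).1 hr
      exact ⟨Submodule.Quotient.mk ⟨r, hr⟩, rfl⟩
    · rintro ⟨s, hs⟩
      obtain ⟨s, rfl⟩ := Submodule.mkQ_surjective _ s
      rw [← hs]
      exact (Submodule.Quotient.mk_eq_zero 𝔟).2 s.2

theorem relLength_eq_zero_iff {𝔞 𝔟 : Ideal R} : relLength 𝔟 𝔞 = 0 ↔ 𝔟 ≤ 𝔞 := by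
  rw [relLength, Module.length_eq_zero_iff, Submodule.Quotient.subsingleton_iff]
  exact Submodule.submoduleOf_eq_top

theorem relLength_anti {𝔞 𝔞' 𝔟 : Ideal R} (h : 𝔞 ≤ 𝔞') : relLength 𝔟 𝔞' ≤ relLength 𝔟 𝔞 :=
  Module.length_le_of_surjective (Submodule.factor (Submodule.comap_mono h))
    (Submodule.factor_surjective _)

theorem relLength_add {𝔞 𝔟 𝔠 : Ideal R} (h : 𝔞 ≤ 𝔟) (h' : 𝔟 ≤ 𝔠) :
    relLength 𝔠 𝔞 = relLength 𝔟 𝔞 + relLength 𝔠 𝔟 := by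
  refine Module.length_eq_add_of_exact
    ((𝔞.submoduleOf 𝔟).mapQ (𝔞.submoduleOf 𝔠) (Submodule.inclusion h') (fun _ h => h))
    (Submodule.factor (Submodule.comap_mono h)) ?_ (Submodule.factor_surjective _) ?_
  · rw [injective_iff_map_eq_zero]
    intro q hq
    obtain ⟨r, rfl⟩ := Submodule.mkQ_surjective _ q
    have hr : (r : R) ∈ 𝔞 := (Submodule.Quotient.mk_eq_zero (𝔞.submoduleOf 𝔠)).1 hq
    exact (Submodule.Quotient.mk_eq_zero (𝔞.submoduleOf 𝔟)).2 hr
  · intro q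
    obtain ⟨r, rfl⟩ := Submodule.mkQ_surjective _ q
    constructor
    · intro hr
      have hr : (r : R) ∈ 𝔟 := (Submodule.Quotient.mk_eq_zero (𝔟.submoduleOf 𝔠)).1 hr
      exact ⟨Submodule.Quotient.mk ⟨r, hr⟩, rfl⟩
    · rintro ⟨s, hs⟩
      obtain ⟨s, rfl⟩ := Submodule.mkQ_surjective _ s
      rw [← hs]
      exact (Submodule.Quotient.mk_eq_zero (𝔟.submoduleOf 𝔠)).2 s.2

/-- Multiplication by `z` maps `R/𝔮` onto `(zR + 𝔞)/𝔞` as soon as `z𝔮 ⊆ 𝔞`. -/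
theorem relLength_span_singleton_sup_le {𝔞 𝔮 : Ideal R} {z : R} (h : ∀ q ∈ 𝔮, q * z ∈ 𝔞) :
    relLength (Ideal.span {z} ⊔ 𝔞) 𝔞 ≤ Module.length R (R ⧸ 𝔮) := by
  set 𝔟 := Ideal.span {z} ⊔ 𝔞
  have hz : z ∈ 𝔟 := Ideal.mem_sup_left (Ideal.mem_span_singleton_self z)
  refine Module.length_le_of_surjective
    (𝔮.mapQ (𝔞.submoduleOf 𝔟) (LinearMap.toSpanSingleton R 𝔟 ⟨z, hz⟩) h) ?_
  intro q
  obtain ⟨⟨w, hw⟩, rfl⟩ := Submodule.mkQ_surjective _ q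
  obtain ⟨u, hu, s, hs, rfl⟩ := Submodule.mem_sup.1 hw
  obtain ⟨r, rfl⟩ := Ideal.mem_span_singleton'.1 hu
  refine ⟨Submodule.Quotient.mk r, ?_⟩
  refine (Submodule.Quotient.eq _).2 ?_
  change r * z - (r * z + s) ∈ 𝔞
  simpa using hs

/-- If the only relations between `x` and `y` are the Koszul relations and `𝔠 = 𝔞 : (x, y)`, then the
sequence `0 → R/𝔠 → (R/𝔞)² → (x, y)/(x, y)𝔞 → 0` with the maps `r ↦ (ry, -rx)` and
`(r, s) ↦ rx + sy` is exact, whence this length formula. -/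
theorem length_koszul {x y : R} (hxy : ∀ r s, r * x + s * y = 0 → ∃ t, r = t * y ∧ s = -(t * x))
    {𝔞 𝔠 : Ideal R} (h𝔠 : ∀ r, r ∈ 𝔠 ↔ r * x ∈ 𝔞 ∧ r * y ∈ 𝔞) :
    2 * Module.length R (R ⧸ 𝔞) =
      Module.length R (R ⧸ 𝔠) + relLength (Ideal.span {x, y}) (Ideal.span {x, y} * 𝔞) := by
  set J := Ideal.span {x, y}
  have hx : x ∈ J := Ideal.subset_span (by simp)
  have hy : y ∈ J := Ideal.subset_span (by simp)
  rw [two_mul, ← Module.length_prod]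
  let f : (R ⧸ 𝔠) →ₗ[R] (R ⧸ 𝔞) × (R ⧸ 𝔞) :=
    (𝔠.mapQ 𝔞 (LinearMap.mulRight R y) fun r hr => ((h𝔠 r).1 hr).2).prod
      (𝔠.mapQ 𝔞 (-LinearMap.mulRight R x) fun r hr => 𝔞.neg_mem ((h𝔠 r).1 hr).1)
  let g : (R ⧸ 𝔞) × (R ⧸ 𝔞) →ₗ[R] (J ⧸ (J * 𝔞).submoduleOf J) :=
    (𝔞.mapQ ((J * 𝔞).submoduleOf J) (LinearMap.toSpanSingleton R J ⟨x, hx⟩) fun r hr => by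
        change r * x ∈ J * 𝔞
        rw [mul_comm r]; exact Ideal.mul_mem_mul hx hr).coprod
      (𝔞.mapQ ((J * 𝔞).submoduleOf J) (LinearMap.toSpanSingleton R J ⟨y, hy⟩) fun r hr => by
        change r * y ∈ J * 𝔞
        rw [mul_comm r]; exact Ideal.mul_mem_mul hy hr)
  have hg0 : ∀ r s : R, g (Submodule.Quotient.mk r, Submodule.Quotient.mk s) = 0 ↔
      r * x + s * y ∈ J * 𝔞 := fun r s =>
    Submodule.Quotient.mk_eq_zero ((J * 𝔞).submoduleOf J)
      (x := (⟨r * x + s * y, J.add_mem (J.mul_mem_left _ hx) (J.mul_mem_left _ hy)⟩ : J))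
  refine Module.length_eq_add_of_exact f g ?_ ?_ ?_
  · rw [injective_iff_map_eq_zero]
    intro q hq
    obtain ⟨r, rfl⟩ := Submodule.mkQ_surjective _ q
    obtain ⟨h1, h2⟩ := Prod.ext_iff.1 hq
    have h1 : r * y ∈ 𝔞 := (Submodule.Quotient.mk_eq_zero 𝔞).1 h1
    have h2 : -(r * x) ∈ 𝔞 := (Submodule.Quotient.mk_eq_zero 𝔞).1 h2
    exact (Submodule.Quotient.mk_eq_zero 𝔠).2 ((h𝔠 r).2 ⟨neg_mem_iff.1 h2, h1⟩)
  · intro q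
    obtain ⟨⟨w, hw⟩, rfl⟩ := Submodule.mkQ_surjective _ q
    obtain ⟨r, s, rfl⟩ := Ideal.mem_span_pair.1 hw
    exact ⟨(Submodule.Quotient.mk r, Submodule.Quotient.mk s), rfl⟩
  · rintro ⟨q, q'⟩
    obtain ⟨r, rfl⟩ := Submodule.mkQ_surjective _ q
    obtain ⟨s, rfl⟩ := Submodule.mkQ_surjective _ q'
    refine (hg0 r s).trans ⟨fun h => ?_, ?_⟩
    · obtain ⟨u, hu, v, hv, huv⟩ : ∃ u ∈ 𝔞, ∃ v ∈ 𝔞, u * x + v * y = r * x + s * y := by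
        rw [show J = Ideal.span {x} ⊔ Ideal.span {y} from Ideal.span_insert x {y},
          Ideal.sup_mul] at h
        obtain ⟨p, hp, q, hq, hpq⟩ := Submodule.mem_sup.1 h
        obtain ⟨u, hu, rfl⟩ := Ideal.mem_span_singleton_mul.1 hp
        obtain ⟨v, hv, rfl⟩ := Ideal.mem_span_singleton_mul.1 hq
        exact ⟨u, hu, v, hv, by rw [← hpq]; ring⟩
      obtain ⟨t, ht1, ht2⟩ := hxy (r - u) (s - v) (by linear_combination -huv)
      refine ⟨Submodule.Quotient.mk t, Prod.ext ?_ ?_⟩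
      · refine (Submodule.Quotient.eq 𝔞).2 ?_
        change t * y - r ∈ 𝔞
        rw [← ht1]; simpa using hu
      · refine (Submodule.Quotient.eq 𝔞).2 ?_
        change -(t * x) - s ∈ 𝔞
        rw [← ht2]; simpa using hv
    · rintro ⟨q, hq⟩
      obtain ⟨t, rfl⟩ := Submodule.mkQ_surjective _ q
      obtain ⟨h1, h2⟩ := Prod.ext_iff.1 hq
      have h1 : t * y - r ∈ 𝔞 := (Submodule.Quotient.eq 𝔞).1 h1
      have h2 : -(t * x) - s ∈ 𝔞 := (Submodule.Quotient.eq 𝔞).1 h2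
      have : r * x + s * y = -(x * (t * y - r) + y * (-(t * x) - s)) := by ring
      rw [this]
      exact neg_mem (add_mem (Ideal.mul_mem_mul hx h1) (Ideal.mul_mem_mul hy h2))

theorem length_quotient_mono {𝔞 𝔟 : Ideal R} (h : 𝔞 ≤ 𝔟) :
    Module.length R (R ⧸ 𝔟) ≤ Module.length R (R ⧸ 𝔞) :=
  Module.length_le_of_surjective (Submodule.factor h) (Submodule.factor_surjective h)

theorem length_quotient_ne_top [IsNoetherianRing R] {𝔞 : Ideal R} [IsArtinianRing (R ⧸ 𝔞)] :
    Module.length R (R ⧸ 𝔞) ≠ ⊤ := by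
  rw [Module.length_ne_top_iff, isFiniteLength_iff_isNoetherian_isArtinian]
  exact ⟨isNoetherian_quotient 𝔞,
    isArtinian_of_surjective_algebraMap (Ideal.Quotient.mk_surjective (I := 𝔞))⟩

theorem length_quotient_pow_ne_top [IsLocalRing R] [IsNoetherianRing R] {𝔞 : Ideal R}
    (h : 𝔞.radical = maximalIdeal R) (n : ℕ) : Module.length R (R ⧸ 𝔞 ^ n) ≠ ⊤ := by
  rcases Nat.eq_zero_or_pos n with rfl | hn
  · have : Subsingleton (R ⧸ 𝔞 ^ 0) := by
      rw [pow_zero, Ideal.one_eq_top]; infer_instance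
    simp
  · have hr : (𝔞 ^ n).radical = maximalIdeal R := by rw [Ideal.radical_pow 𝔞 hn.ne', h]
    have hm : maximalIdeal R ∈ (𝔞 ^ n).minimalPrimes := by
      rw [← Ideal.radical_minimalPrimes, hr, Ideal.minimalPrimes_eq_subsingleton_self]
      rfl
    have := IsLocalRing.quotient_artinian_of_mem_minimalPrimes_of_isLocalRing (𝔞 ^ n) hm
    exact length_quotient_ne_top

/-- The length of `𝔞/𝔪𝔞` is the minimal number of generators of `𝔞`. -/
theorem relLength_maximalIdeal_mul [IsLocalRing R] [IsNoetherianRing R] (𝔞 : Ideal R) :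
    relLength 𝔞 (maximalIdeal R * 𝔞) = 𝔞.spanFinrank := by
  have hfg : 𝔞.FG := IsNoetherian.noetherian 𝔞
  rw [spanFinrank_eq_finrank_quotient 𝔞 hfg]
  have hsub : (maximalIdeal R * 𝔞).submoduleOf 𝔞 = maximalIdeal R • (⊤ : Submodule R 𝔞) := by
    refine Submodule.map_injective_of_injective 𝔞.subtype_injective ?_
    rw [Submodule.map_smul'', Submodule.map_top, Submodule.range_subtype]
    exact (Submodule.map_comap_subtype 𝔞 _).trans (inf_eq_right.2 Ideal.mul_le_right)
  rw [relLength, hsub]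
  let : Field (R ⧸ maximalIdeal R) := Ideal.Quotient.field _
  have : Module.Finite R 𝔞 := Module.Finite.iff_fg.mpr hfg
  have : Module.Finite (R ⧸ maximalIdeal R) (𝔞 ⧸ maximalIdeal R • (⊤ : Submodule R 𝔞)) :=
    Module.Finite.of_restrictScalars_finite R _ _
  rw [Module.length_eq_of_surjective (R := R ⧸ maximalIdeal R) Ideal.Quotient.mk_surjective]
  exact Module.length_eq_finrank _ _

/-- The number of generators of an ideal `𝔞` of finite colength that contains `a` exceeds the
colength of `(a, b)` by at most one. This is the bound of the number of generators by the
multiplicity, applied to the ring `R/a` of smaller dimension. -/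
theorem spanFinrank_le_one_add_length [IsLocalRing R] [IsNoetherianRing R] {a b : R} {𝔞 : Ideal R}
    (ha : a ∈ 𝔞) (hb : b ∈ maximalIdeal R) (h : Module.length R (R ⧸ 𝔞) ≠ ⊤) :
    (𝔞.spanFinrank : ℕ∞) ≤ 1 + Module.length R (R ⧸ Ideal.span {b} ⊔ Ideal.span {a}) := by
  set 𝔪 := maximalIdeal R
  set 𝔟 := Ideal.span {a} ⊔ Ideal.span {b} * 𝔞
  set 𝔠 := Ideal.span {b} ⊔ Ideal.span {a}
  have ha' : Ideal.span {a} ≤ 𝔞 := (Ideal.span_singleton_le_iff_mem _).2 ha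
  have hb' : Ideal.span {b} ≤ 𝔪 := (Ideal.span_singleton_le_iff_mem _).2 hb
  have h𝔟 : 𝔟 ≤ 𝔞 := sup_le ha' Ideal.mul_le_right
  have h𝔟𝔠 : 𝔟 ≤ 𝔠 := sup_le le_sup_right (Ideal.mul_le_left.trans le_sup_left)
  -- `𝔠/𝔟` is generated by the class of `b`, which is annihilated by `𝔞`.
  have h1 : relLength 𝔠 𝔟 ≤ Module.length R (R ⧸ 𝔞) := by
    have h𝔠 : 𝔠 = Ideal.span {b} ⊔ 𝔟 :=
      le_antisymm (sup_le le_sup_left (le_sup_of_le_right le_sup_left)) (sup_le le_sup_left h𝔟𝔠)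
    rw [h𝔠]
    refine relLength_span_singleton_sup_le fun q hq => Ideal.mem_sup_right ?_
    rw [mul_comm q]
    exact Ideal.mul_mem_mul (Ideal.mem_span_singleton_self b) hq
  -- Compare the two ways from `𝔟` up to `R`, through `𝔞` and through `𝔠`.
  have h2 : relLength 𝔞 𝔟 ≤ Module.length R (R ⧸ 𝔠) := by
    have e1 := length_quotient_eq_relLength_add h𝔟
    rw [length_quotient_eq_relLength_add h𝔟𝔠, add_comm] at e1
    refine (ENat.add_le_add_iff_right h).1 (e1 ▸ ?_)
    gcongr
  have h3 : relLength (Ideal.span {a} ⊔ 𝔪 * 𝔞) (𝔪 * 𝔞) ≤ 1 := by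
    have : IsSimpleModule R (R ⧸ 𝔪) := by
      rw [isSimpleModule_iff_isCoatom]
      exact Ideal.isMaximal_def.1 inferInstance
    rw [← Module.length_eq_one R (R ⧸ 𝔪)]
    exact relLength_span_singleton_sup_le fun q hq => Ideal.mul_mem_mul hq ha
  rw [← relLength_maximalIdeal_mul, relLength_add (𝔟 := Ideal.span {a} ⊔ 𝔪 * 𝔞) le_sup_right
    (sup_le ha' Ideal.mul_le_right)]
  refine add_le_add h3 ((relLength_anti ?_).trans h2)
  exact sup_le_sup_left (Ideal.mul_mono_left hb') _

theorem length_quotient_sup_span_pow_le (𝔟 : Ideal R) (a : R) (n : ℕ) :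
    Module.length R (R ⧸ 𝔟 ⊔ Ideal.span {a ^ n}) ≤
      n * Module.length R (R ⧸ 𝔟 ⊔ Ideal.span {a}) := by
  induction n with
  | zero =>
    have : Subsingleton (R ⧸ 𝔟 ⊔ Ideal.span {a ^ 0}) := by
      simp
    simp
  | succ n ih =>
    have h : 𝔟 ⊔ Ideal.span {a ^ (n + 1)} ≤ 𝔟 ⊔ Ideal.span {a ^ n} :=
      sup_le_sup_left (Ideal.span_singleton_le_span_singleton.2 (pow_dvd_pow a n.le_succ)) _
    rw [length_quotient_eq_relLength_add h, Nat.cast_succ, add_mul, one_mul, add_comm]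
    refine add_le_add ih ?_
    have e : 𝔟 ⊔ Ideal.span {a ^ n} = Ideal.span {a ^ n} ⊔ (𝔟 ⊔ Ideal.span {a ^ (n + 1)}) :=
      le_antisymm (sup_le (le_sup_of_le_right le_sup_left) le_sup_left) (sup_le le_sup_right h)
    rw [e]
    refine relLength_span_singleton_sup_le fun q hq => ?_
    obtain ⟨u, hu, v, hv, rfl⟩ := Submodule.mem_sup.1 hq
    obtain ⟨t, rfl⟩ := Ideal.mem_span_singleton'.1 hv
    rw [add_mul]
    refine add_mem (Ideal.mem_sup_left (Ideal.mul_mem_right _ _ hu)) (Ideal.mem_sup_right ?_)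
    exact Ideal.mem_span_singleton'.2 ⟨t, by ring⟩

end Length

/-! ### Regular sequences of length two -/

section RegularPair

variable {R : Type*} [CommRing R]

/-- `a, b` is a weakly regular sequence of length two on `R`, spelled out elementwise: `a` is a
nonzerodivisor, and `b` is a nonzerodivisor modulo `a`. -/
def IsRegularPair (a b : R) : Prop :=
  (∀ r, a * r = 0 → r = 0) ∧ ∀ r s, b * r = a * s → ∃ t, r = a * t

theorem IsRegularPair.pow {a b : R} (h : IsRegularPair a b) (m n : ℕ) :
    IsRegularPair (a ^ m) (b ^ n) := by
  obtain ⟨ha, hb⟩ := h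
  have ha' : ∀ m : ℕ, ∀ r, a ^ m * r = 0 → r = 0 := by
    intro m
    induction m with
    | zero => intro r hr; simpa using hr
    | succ m ih => intro r hr; exact ha r (ih _ (by rw [← hr]; ring))
  have hb' : ∀ m : ℕ, ∀ r s, b * r = a ^ m * s → ∃ t, r = a ^ m * t := by
    intro m
    induction m with
    | zero => intro r s _; exact ⟨r, by simp⟩
    | succ m ih =>
      intro r s hr
      obtain ⟨u, rfl⟩ := hb r (a ^ m * s) (by rw [hr]; ring)
      obtain ⟨t, rfl⟩ := ih u s (by
        refine sub_eq_zero.1 (ha _ ?_)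
        linear_combination hr)
      exact ⟨t, by ring⟩
  refine ⟨ha' m, ?_⟩
  induction n with
  | zero => intro r s hr; exact ⟨s, by simpa using hr⟩
  | succ n ih =>
    intro r s hr
    obtain ⟨t, ht⟩ := ih (b * r) s (by rw [← hr]; ring)
    exact hb' m r t ht

/-- An ideal generated by two elements `x, y` that contains a regular sequence of length two of a
local ring has only the Koszul relations: this is the depth-sensitivity of the Koszul complex in
the simplest case. Write `a` and `b` as combinations of `x` and `y` and apply Cramer's rule. -/
theorem IsRegularPair.exists_koszul [IsLocalRing R] [IsNoetherianRing R] {a b x y : R}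
    (h : IsRegularPair a b)
    (ha : a ∈ Ideal.span {x, y}) (hb : b ∈ Ideal.span {x, y}) (hy : y ∈ maximalIdeal R)
    (r s : R) (hrs : r * x + s * y = 0) : ∃ t, r = t * y ∧ s = -(t * x) := by
  obtain ⟨h1, h2⟩ := h
  obtain ⟨a₁, a₂, rfl⟩ := Ideal.mem_span_pair.1 ha
  obtain ⟨b₁, b₂, rfl⟩ := Ideal.mem_span_pair.1 hb
  set a := a₁ * x + a₂ * y with ha
  set b := b₁ * x + b₂ * y with hb
  -- The annihilator `N` of `x` satisfies `N ⊆ yN`, hence vanishes by Nakayama's lemma.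
  have hx : ∀ u, x * u = 0 → u = 0 := by
    set N : Ideal R := LinearMap.ker (LinearMap.mulLeft R x)
    have hN : N ≤ maximalIdeal R • N := by
      intro u hu
      have hu : x * u = 0 := hu
      obtain ⟨v, hv⟩ := h2 (a₂ * u) (b₂ * u) (by
        rw [ha, hb]; linear_combination (b₁ * a₂ - a₁ * b₂) * hu)
      have hv' : u = y * v := by
        refine sub_eq_zero.1 (h1 _ ?_)
        linear_combination a₁ * hu + y * hv + u * ha
      have hxv : x * v = 0 := h1 _ (by linear_combination a₂ * hu - x * hv)
      rw [hv']
      exact Submodule.smul_mem_smul hy hxv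
    have : N = ⊥ := Submodule.eq_bot_of_le_smul_of_le_jacobson_bot (maximalIdeal R) N
      (IsNoetherian.noetherian N) hN (by rw [jacobson_eq_maximalIdeal ⊥ bot_ne_top])
    intro u hu
    exact (Submodule.mem_bot R).1 (this ▸ (show u ∈ N from hu))
  obtain ⟨p, hp⟩ := h2 (a₁ * s - a₂ * r) (b₁ * s - b₂ * r) (by
    refine sub_eq_zero.1 (hx _ ?_)
    rw [ha, hb]; linear_combination x * (a₁ * b₂ - a₂ * b₁) * hrs)
  have hs : s = x * p := by
    refine sub_eq_zero.1 (h1 _ ?_)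
    rw [ha] at hp ⊢
    linear_combination a₂ * hrs + x * hp
  refine ⟨-p, ?_, by rw [hs]; ring⟩
  refine sub_eq_zero.1 (hx _ ?_)
  linear_combination hrs - y * hs

/-- A Cohen–Macaulay local ring of dimension two has a regular sequence of length two, and
the quotient by it has dimension zero. -/
theorem IsCohenMacaulayLocal.exists_isRegularPair [IsLocalRing R] (hCM : IsCohenMacaulayLocal R)
    (hdim : ringKrullDim R = 2) : ∃ a ∈ maximalIdeal R, ∃ b ∈ maximalIdeal R,
      IsRegularPair a b ∧ Module.length R (R ⧸ Ideal.span {b} ⊔ Ideal.span {a}) ≠ ⊤ := by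
  obtain ⟨hN, rs, hrs, hreg, hlen⟩ := hCM
  have hlen : rs.length = 2 := by
    rw [hdim] at hlen
    exact_mod_cast hlen.symm
  obtain ⟨a, b, rfl⟩ := List.length_eq_two.1 hlen
  refine ⟨a, hrs a (by simp), b, hrs b (by simp), ⟨fun r hr => ?_, fun r s hr => ?_⟩, ?_⟩
  · have h := (isSMulRegular_quotient_iff_mem_of_smul_mem _ _).1
      (hreg.regular_mod_prev 0 (by simp)) r
    simpa [hr] using h
  · have h := (isSMulRegular_quotient_iff_mem_of_smul_mem _ _).1
      (hreg.regular_mod_prev 1 (by simp)) r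
    simp only [List.take_succ_cons, List.take_zero, Ideal.ofList_singleton, smul_eq_mul,
      Ideal.mul_top, List.getElem_cons_succ, List.getElem_cons_zero, hr] at h
    obtain ⟨t, ht⟩ := Ideal.mem_span_singleton.1
      (h (Ideal.mul_mem_right _ _ (Ideal.mem_span_singleton_self a)))
    exact ⟨t, ht⟩
  · have h := ringKrullDim_add_length_eq_ringKrullDim_of_isRegular _ hreg
    have e : Ideal.ofList [a, b] = Ideal.span {b} ⊔ Ideal.span {a} := by
      simp [sup_comm]
    rw [hdim, e] at h
    have h0 : ringKrullDim (R ⧸ Ideal.span {b} ⊔ Ideal.span {a}) = 0 :=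
      ENat.WithBot.add_natCast_cancel (c := 2).1 (by simpa using h)
    have : IsArtinianRing (R ⧸ Ideal.span {b} ⊔ Ideal.span {a}) := by
      rw [isArtinianRing_iff_krullDimLE_zero, Ring.KrullDimLE, Order.krullDimLE_iff]
      exact h0.le
    exact length_quotient_ne_top
end RegularPair

/-! ### The Ratliff–Rush filtration -/

section RatliffRush

variable {R : Type*} [CommRing R] {I J : Ideal R} {𝓘 : ℤ → Ideal R}

theorem IsAdmissible.antitone (h : IsAdmissible I 𝓘) : Antitone 𝓘 :=
  antitone_int_of_succ_le h.succ_le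

theorem IsAdmissible.le_one (h : IsAdmissible I 𝓘) : I ≤ 𝓘 1 := by
  simpa using h.pow_le 1

/-- A reduction satisfies `I_{n₀+t} = J^t I_{n₀}` for some `n₀` and all `t`. -/
theorem IsReduction.exists_pow_mul_eq (hJ : IsReduction 𝓘 J) :
    ∃ n₀ : ℕ, ∀ n : ℤ, n₀ ≤ n → ∀ t : ℕ, J ^ t * 𝓘 n = 𝓘 (n + t) := by
  obtain ⟨n₀, hn₀⟩ := Filter.eventually_atTop.1 hJ.2
  refine ⟨n₀.toNat, fun n hn t => ?_⟩
  induction t with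
  | zero => simp
  | succ t ih =>
    rw [pow_succ', mul_assoc, ih, hn₀ _ (by omega)]
    push_cast
    rw [add_assoc]

theorem le_ratliffRush (n : ℤ) : 𝓘 n ≤ ratliffRush I 𝓘 n := by
  refine le_trans ?_ (le_iSup _ 0)
  intro a ha
  rw [Submodule.mem_colon]
  intro b _
  simpa using (𝓘 n).mul_mem_right b ha

theorem ratliffRush_of_nonpos (h : IsAdmissible I 𝓘) {n : ℤ} (hn : n ≤ 0) :
    ratliffRush I 𝓘 n = ⊤ := by
  refine top_le_iff.1 (le_trans ?_ ((h.pow_le n).trans (le_ratliffRush n)))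
  simp [Int.toNat_of_nonpos hn]

theorem mul_ratliffRush_le (h : IsAdmissible I 𝓘) (hJI : J ≤ I) (n : ℤ) :
    J * ratliffRush I 𝓘 n ≤ ratliffRush I 𝓘 (n + 1) := by
  refine Ideal.mul_le.2 fun c hc a ha => ?_
  rw [mem_ratliffRush h] at ha ⊢
  obtain ⟨t, ht⟩ := ha
  refine ⟨t, fun b hb => ?_⟩
  have := h.mul_le 1 (n + t) (Ideal.mul_mem_mul (h.le_one (hJI hc)) (ht b hb))
  rwa [← mul_assoc, show (1 : ℤ) + (n + t) = n + 1 + t by ring] at this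

/-- The Ratliff–Rush filtration satisfies `(Ĩ_{n+1} : J) ⊆ Ĩ_n` in every degree: if `aJ ⊆ Ĩ_{n+1}`,
then `a I^{n₀+s} ⊆ a J^s I_{n₀} ⊆ I_{n+s} I_{n₀}` for large `s`. -/
theorem mem_ratliffRush_of_forall_mul_mem (h : IsAdmissible I 𝓘) (hJ : IsReduction 𝓘 J)
    (hJI : J ≤ I) {x y : R} (hxy : J = Ideal.span {x, y}) {n : ℤ} {a : R}
    (hx : a * x ∈ ratliffRush I 𝓘 (n + 1)) (hy : a * y ∈ ratliffRush I 𝓘 (n + 1)) :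
    a ∈ ratliffRush I 𝓘 n := by
  obtain ⟨n₀, hn₀⟩ := hJ.exists_pow_mul_eq
  rw [mem_ratliffRush h] at hx hy ⊢
  obtain ⟨t₁, ht₁⟩ := hx
  obtain ⟨t₂, ht₂⟩ := hy
  -- With the exponent `t₁ + t₂` both memberships hold at once.
  have key : ∀ z ∈ J ^ (t₁ + t₂ + 1), a * z ∈ 𝓘 (n + 1 + ((t₁ + t₂ : ℕ) : ℤ)) := by
    intro z hz
    rw [pow_succ'] at hz
    refine Submodule.mul_induction_on hz (fun p hp q hq => ?_) fun p q hp hq => ?_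
    · rw [hxy] at hp
      obtain ⟨u, v, rfl⟩ := Ideal.mem_span_pair.1 hp
      have hz' : ∀ t t' : ℕ, ∀ w, (∀ b ∈ I ^ t, w * b ∈ 𝓘 (n + 1 + t)) → ∀ q ∈ J ^ (t + t'),
          w * q ∈ 𝓘 (n + 1 + ((t + t' : ℕ) : ℤ)) := by
        intro t t' w hw q hq
        rw [pow_add] at hq
        refine Submodule.mul_induction_on hq (fun c hc d hd => ?_) fun c d hc hd => ?_
        · have hd' : d ∈ 𝓘 t' := by simpa using h.pow_le t' (Ideal.pow_right_mono hJI _ hd)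
          have := h.mul_le _ _ (Ideal.mul_mem_mul (hw c (Ideal.pow_right_mono hJI _ hc)) hd')
          rw [mul_assoc] at this
          rwa [Nat.cast_add, ← add_assoc]
        · rw [mul_add]; exact add_mem hc hd
      have e1 := hz' t₁ t₂ _ ht₁ q hq
      have e2 := hz' t₂ t₁ _ ht₂ q (by rwa [add_comm])
      rw [add_comm t₂] at e2
      rw [show a * ((u * x + v * y) * q) = u * (a * x * q) + v * (a * y * q) by ring]
      exact add_mem (Ideal.mul_mem_left _ _ e1) (Ideal.mul_mem_left _ _ e2)
    · rw [mul_add]; exact add_mem hp hq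
  refine ⟨n₀ + (t₁ + t₂ + 1), fun b hb => ?_⟩
  have hb' : b ∈ J ^ (t₁ + t₂ + 1) * 𝓘 n₀ := by
    rw [hn₀ n₀ le_rfl]
    have := h.pow_le ((n₀ + (t₁ + t₂ + 1) : ℕ) : ℤ) (by rwa [Int.toNat_natCast])
    rwa [Nat.cast_add] at this
  refine Submodule.mul_induction_on hb' (fun p hp q hq => ?_) fun p q hp hq => ?_
  · have := h.mul_le _ _ (Ideal.mul_mem_mul (key p hp) hq)
    rw [mul_assoc] at this
    convert this using 2
    push_cast
    ring
  · rw [mul_add]; exact add_mem hp hq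

/-- If `J` contains a nonzerodivisor `c`, then `(I_{n+1} : J) ⊆ I_n` for large `n`. By Artin–Rees,
`(I_{n+m} : c) ⊆ J^n` for some `m`, so the ideals `(I_{n+m} : J)` form a `J`-filtration contained in
the `J`-adic one and hence stable; in large degrees they are `J (I_{n+m-1} : J) ⊆ I_{n+m-1}`. -/
theorem IsReduction.exists_colon_le [IsNoetherianRing R] (h : IsAdmissible I 𝓘)
    (hJ : IsReduction 𝓘 J) {c : R} (hcJ : c ∈ J) (hc : ∀ r, c * r = 0 → r = 0) :
    ∃ n₁ : ℕ, ∀ n : ℤ, n₁ ≤ n → ∀ a, (∀ z ∈ J, a * z ∈ 𝓘 (n + 1)) → a ∈ 𝓘 n := by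
  have hJ1 : J ≤ 𝓘 1 := hJ.1
  have hmul : ∀ n : ℤ, J * 𝓘 n ≤ 𝓘 (n + 1) := fun n => by
    rw [add_comm]
    exact (Ideal.mul_mono_left hJ1).trans (h.mul_le 1 n)
  let F : J.Filtration R :=
    { N := fun n => 𝓘 n
      mono := fun n => by simpa using h.succ_le n
      smul_le := fun n => by simpa using hmul n }
  have hF : F.Stable := by
    obtain ⟨n₀, hn₀⟩ := hJ.exists_pow_mul_eq
    exact ⟨n₀, fun n hn => by simpa [F] using hn₀ n (by exact_mod_cast hn) 1⟩
  -- Artin–Rees for the principal ideal generated by `c`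
  obtain ⟨m, hm⟩ := (hF.inter_right (J.trivialFiltration (Ideal.span {c}))).exists_pow_smul_eq
  have hcolon : ∀ k : ℕ, ∀ a, a * c ∈ 𝓘 ((m + k : ℕ) : ℤ) → a ∈ J ^ k := by
    intro k a ha
    have h1 : a * c ∈ (F ⊓ J.trivialFiltration (Ideal.span {c})).N (m + k) :=
      ⟨ha, Ideal.mem_span_singleton'.2 ⟨a, rfl⟩⟩
    rw [hm k] at h1
    have h2 : a * c ∈ J ^ k * Ideal.span {c} :=
      Submodule.smul_mono le_rfl (inf_le_right (a := F.N m)) h1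
    rw [mul_comm (J ^ k), Ideal.mem_span_singleton_mul] at h2
    obtain ⟨b, hb, hbc⟩ := h2
    have : b = a := sub_eq_zero.1 (hc _ (by linear_combination hbc))
    exact this ▸ hb
  let L : J.Filtration R :=
    { N := fun k => (𝓘 ((m + k : ℕ) : ℤ)).colon (J : Set R)
      mono := fun k a ha => by
        rw [Submodule.mem_colon] at ha ⊢
        exact fun z hz => h.antitone (by push_cast; omega) (ha z hz)
      smul_le := fun k => Submodule.smul_le.2 fun z hz a ha => by
        rw [Submodule.mem_colon] at ha ⊢
        intro w hw
        have := hmul _ (Ideal.mul_mem_mul hz (ha w hw))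
        rw [smul_eq_mul, smul_eq_mul, mul_assoc, ← add_assoc, Nat.cast_succ]
        exact this }
  have hL : L.Stable := by
    refine (Ideal.stableFiltration_stable J (⊤ : Ideal R)).of_le fun k a ha => ?_
    have ha := hcolon k a ((Submodule.mem_colon.1 ha) c hcJ)
    simpa using ha
  obtain ⟨k₀, hk₀⟩ := hL
  refine ⟨m + k₀, fun n hn a ha => ?_⟩
  obtain ⟨k, rfl⟩ : ∃ k : ℕ, n = ((m + k : ℕ) : ℤ) :=
    ⟨(n - m).toNat, by push_cast; omega⟩
  have h1 : a ∈ L.N (k + 1) := Submodule.mem_colon.2 fun z hz => by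
    rw [← add_assoc, Nat.cast_succ]
    exact ha z hz
  rw [← hk₀ k (by omega)] at h1
  refine (Submodule.smul_le.2 fun z hz b hb => ?_ : J • L.N k ≤ _) h1
  have := Submodule.mem_colon.1 hb z hz
  rwa [smul_eq_mul, mul_comm] at this

theorem ratliffRush_eventually_eq [IsNoetherianRing R] (h : IsAdmissible I 𝓘)
    (hJ : IsReduction 𝓘 J) (hJI : J ≤ I) {c : R} (hcJ : c ∈ J) (hc : ∀ r, c * r = 0 → r = 0) :
    ∃ n₁ : ℕ, ∀ n : ℤ, n₁ ≤ n → ratliffRush I 𝓘 n = 𝓘 n := by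
  obtain ⟨n₁, hn₁⟩ := hJ.exists_colon_le h hcJ hc
  refine ⟨n₁, fun n hn => le_antisymm (fun a ha => ?_) (le_ratliffRush n)⟩
  obtain ⟨t, ht'⟩ := (mem_ratliffRush h n a).1 ha
  have ht : ∀ b ∈ J ^ t, a * b ∈ 𝓘 (n + t) := fun b hb => ht' b (Ideal.pow_right_mono hJI _ hb)
  clear ha ht'
  induction t with
  | zero => simpa using ht 1 (by simp)
  | succ t ih =>
    refine ih fun b hb => hn₁ _ (by omega) _ fun z hz => ?_
    have := ht (b * z) (by rw [pow_succ]; exact Ideal.mul_mem_mul hb hz)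
    rwa [← mul_assoc, Nat.cast_succ, ← add_assoc] at this

end RatliffRush

/-! ### Reductions generated by two elements -/

section NorthcottRees

variable {R : Type*} [CommRing R]

/-- If `x ≡ αz` modulo `P`, then `x ^ j` may be replaced by `(αz) ^ j` in a form of degree `d + 1` in
elements of `J`, modulo `P * J ^ d`. -/
theorem pow_mul_sub_mem {J P : Ideal R} {x z α : R} (hx : x ∈ J) (hz : z ∈ J) (hP : x - α * z ∈ P)
    {d : ℕ} (j n : ℕ) (w : R) (hw : w ∈ J ^ n) (hd : j + n = d + 1) :
    x ^ j * w - α ^ j * z ^ j * w ∈ P * J ^ d := by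
  induction j generalizing n w with
  | zero => simp
  | succ j ih =>
    have h1 := ih (n + 1) (x * w) (by rw [pow_succ']; exact Ideal.mul_mem_mul hx hw) (by omega)
    have h2 : z ^ j * w ∈ J ^ d := by
      rw [show d = j + n by omega, pow_add]
      exact Ideal.mul_mem_mul (Ideal.pow_mem_pow hz j) hw
    have h3 := Ideal.mul_mem_left _ (α ^ j) (Ideal.mul_mem_mul hP h2)
    convert add_mem h1 h3 using 1
    ring

theorem sup_span_singleton_pow_le {J K : Ideal R} {z : R} (hK : K ≤ J) (hz : z ∈ J) (n : ℕ) :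
    (K ⊔ Ideal.span {z}) ^ (n + 1) ≤ K * J ^ n ⊔ Ideal.span {z ^ (n + 1)} := by
  induction n with
  | zero => simp
  | succ n ih =>
    have hz' : Ideal.span {z} ≤ J := (Ideal.span_singleton_le_iff_mem _).2 hz
    rw [pow_succ', Ideal.sup_mul]
    refine sup_le (le_sup_of_le_left (Ideal.mul_mono_right (Ideal.pow_right_mono ?_ _))) ?_
    · exact sup_le hK hz'
    · refine (Ideal.mul_mono_right ih).trans ?_
      rw [Ideal.mul_sup]
      refine sup_le (le_sup_of_le_left ?_) (le_sup_of_le_right ?_)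
      · rw [mul_left_comm, pow_succ']
        exact Ideal.mul_mono_right (Ideal.mul_mono_left hz')
      · rw [Ideal.span_singleton_mul_span_singleton, ← pow_succ']

theorem pow_add_le_pow_mul {J K : Ideal R} {s : ℕ} (h : J ^ (s + 1) ≤ K * J ^ s) (n : ℕ) :
    J ^ (s + n) ≤ K ^ n * J ^ s := by
  induction n with
  | zero => simp
  | succ n ih =>
    calc J ^ (s + (n + 1)) = J * J ^ (s + n) := by rw [← pow_succ', add_assoc]
      _ ≤ J * (K ^ n * J ^ s) := Ideal.mul_mono_right ih
      _ = K ^ n * J ^ (s + 1) := by rw [pow_succ']; ring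
      _ ≤ K ^ n * (K * J ^ s) := Ideal.mul_mono_right h
      _ = K ^ (n + 1) * J ^ s := by rw [pow_succ, mul_assoc]

variable [IsLocalRing R] [IsNoetherianRing R]

/-- More elements of an ideal than it has generators satisfy a linear relation modulo `𝔪𝔞` with a
unit among its coefficients. -/
theorem exists_relation_of_spanFinrank_lt {ι : Type*} [Fintype ι] {𝔞 : Ideal R} (v : ι → R)
    (hv : ∀ i, v i ∈ 𝔞) (hcard : 𝔞.spanFinrank < Fintype.card ι) :
    ∃ c : ι → R, (∃ i, residue R (c i) ≠ 0) ∧ ∑ i, c i * v i ∈ maximalIdeal R * 𝔞 := by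
  have hfg : 𝔞.FG := IsNoetherian.noetherian 𝔞
  obtain ⟨g, hg⟩ : ∃ g : Fin 𝔞.spanFinrank → R, Ideal.span (Set.range g) = 𝔞 := by
    obtain ⟨G, hG, hG'⟩ := Submodule.FG.exists_span_finset_card_eq_spanFinrank hfg
    refine ⟨fun q => (G.equivFinOfCardEq hG).symm q, ?_⟩
    refine Eq.trans ?_ hG'
    congr 1
    ext w
    simp only [Set.mem_range, SetLike.mem_coe]
    constructor
    · rintro ⟨q, rfl⟩
      exact Subtype.property _
    · exact fun hw => ⟨G.equivFinOfCardEq hG ⟨w, hw⟩, by simp⟩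
  have hA : ∀ i, ∃ A : Fin 𝔞.spanFinrank → R, ∑ q, A q * g q = v i := fun i =>
    Ideal.mem_span_range_iff_exists_fun.1 (by rw [hg]; exact hv i)
  choose A hA using hA
  have hdep : ¬ LinearIndependent (ResidueField R) fun i q => residue R (A i q) := fun h => by
    have := h.fintype_card_le_finrank
    simp at this
    omega
  obtain ⟨c, hc, i₀, hi₀⟩ := Fintype.not_linearIndependent_iff.1 hdep
  choose c' hc' using fun i => residue_surjective (c i)
  refine ⟨c', ⟨i₀, by rwa [hc']⟩, ?_⟩
  have : ∑ i, c' i * v i = ∑ q, (∑ i, c' i * A i q) * g q := by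
    simp_rw [← hA, Finset.mul_sum, Finset.sum_mul]
    rw [Finset.sum_comm]
    simp_rw [mul_assoc]
  rw [this]
  refine sum_mem fun q _ => Ideal.mul_mem_mul ?_ ?_
  · rw [← residue_eq_zero_iff, map_sum]
    simpa [hc'] using congrFun hc q
  · rw [← hg]
    exact Ideal.subset_span ⟨q, rfl⟩

/-- Over an infinite field, a nonzero polynomial in two variables does not vanish everywhere. -/
theorem exists_sum_mul_pow_ne_zero {k : Type*} [Field k] [Infinite k] {e : ℕ}
    (c : Fin e × Fin e → k) {p₀ : Fin e × Fin e} (hp₀ : c p₀ ≠ 0) :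
    ∃ α β : k, ∑ p, c p * (α ^ (p.1 : ℕ) * β ^ (p.2 : ℕ)) ≠ 0 := by
  let E : Fin e × Fin e → (Fin 2 →₀ ℕ) := fun p =>
    Finsupp.single 0 (p.1 : ℕ) + Finsupp.single 1 (p.2 : ℕ)
  have hE : Function.Injective E := by
    intro p q hpq
    have h0 := DFunLike.congr_fun hpq 0
    have h1 := DFunLike.congr_fun hpq 1
    simp [E] at h0 h1
    exact Prod.ext (Fin.ext h0) (Fin.ext h1)
  let f : MvPolynomial (Fin 2) k := ∑ p, MvPolynomial.monomial (E p) (c p)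
  have hf : f ≠ 0 := by
    intro h
    have h1 := congrArg (MvPolynomial.coeff (E p₀)) h
    simp only [f, MvPolynomial.coeff_sum, MvPolynomial.coeff_monomial, hE.eq_iff,
      Finset.sum_ite_eq', Finset.mem_univ, if_true, MvPolynomial.coeff_zero] at h1
    exact hp₀ h1
  by_contra! h
  refine hf (MvPolynomial.funext fun v => ?_)
  rw [map_zero, ← h (v 0) (v 1), map_sum]
  refine Finset.sum_congr rfl fun p _ => ?_
  rw [MvPolynomial.eval_monomial]
  simp [E, Finsupp.prod_add_index', pow_add]

/-- Three elements among the generators of a reduction can be replaced by two linear combinations of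
them, provided that the number of generators of `J ^ d` grows at most linearly. The monomials of
degree `d` in `x, y, z` outnumber the generators of `J ^ d`, so there is a form of degree `d` that
vanishes at `x, y, z` modulo `𝔪 J ^ d`; after a linear change of coordinates, possible over an
infinite field, the form is monic in `z`, so that `z` is redundant by Nakayama's lemma. -/
theorem exists_two_of_three [Infinite (ResidueField R)] {J : Ideal R} {C : ℕ}
    (hC : ∀ d, (J ^ d).spanFinrank ≤ 1 + d * C) {L : Ideal R} {x y z : R}
    (hle : L ⊔ Ideal.span {x, y, z} ≤ J)
    (hred : ∃ s, J ^ (s + 1) ≤ (L ⊔ Ideal.span {x, y, z}) * J ^ s) :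
    ∃ x' y', L ⊔ Ideal.span {x', y'} ≤ J ∧
      ∃ s, J ^ (s + 1) ≤ (L ⊔ Ideal.span {x', y'}) * J ^ s := by
  obtain ⟨s, hs⟩ := hred
  have hmem : ∀ w ∈ ({x, y, z} : Set R), w ∈ J := fun w hw =>
    hle (Ideal.mem_sup_right (Ideal.subset_span hw))
  have hx := hmem x (by simp)
  have hy := hmem y (by simp)
  have hz := hmem z (by simp)
  -- The `e²` monomials `x ^ i * y ^ j * z ^ (2 * e - i - j)` with `i, j < e` suffice.
  -- The value of `e` makes `e² > 1 + 2 * e * C`.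
  set e := 2 * C + 2
  have he : 2 * C + 2 = e := rfl
  have hmon : ∀ p : Fin e × Fin e,
      x ^ (p.1 : ℕ) * (y ^ (p.2 : ℕ) * z ^ (2 * e - p.1 - p.2)) ∈ J ^ (2 * e) := by
    intro p
    have h1 := p.1.2
    have h2 := p.2.2
    have : 2 * e = p.1 + (p.2 + (2 * e - p.1 - p.2)) := by omega
    rw [show J ^ (2 * e) = J ^ (p.1 : ℕ) * (J ^ (p.2 : ℕ) * J ^ (2 * e - p.1 - p.2)) by
      rw [← pow_add, ← pow_add, ← this]]
    exact Ideal.mul_mem_mul (Ideal.pow_mem_pow hx _)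
      (Ideal.mul_mem_mul (Ideal.pow_mem_pow hy _) (Ideal.pow_mem_pow hz _))
  obtain ⟨c, ⟨p₀, hp₀⟩, hc⟩ := exists_relation_of_spanFinrank_lt _ hmon (by
    refine (hC _).trans_lt ?_
    rw [Fintype.card_prod, Fintype.card_fin, ← he]
    nlinarith)
  obtain ⟨α', β', hαβ⟩ := exists_sum_mul_pow_ne_zero (fun p => residue R (c p)) hp₀
  obtain ⟨α, rfl⟩ := residue_surjective α'
  obtain ⟨β, rfl⟩ := residue_surjective β'
  set x' := x - α * z
  set y' := y - β * z
  set K := L ⊔ Ideal.span {x', y'}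
  have hx' : x' ∈ K := Ideal.mem_sup_right (Ideal.subset_span (by simp))
  have hy' : y' ∈ K := Ideal.mem_sup_right (Ideal.subset_span (by simp))
  have hKJ : K ≤ J := by
    refine sup_le (le_sup_left.trans hle) (Ideal.span_le.2 ?_)
    rintro w (rfl | rfl)
    · exact sub_mem hx (Ideal.mul_mem_left _ _ hz)
    · exact sub_mem hy (Ideal.mul_mem_left _ _ hz)
  have hKz : L ⊔ Ideal.span {x, y, z} ≤ K ⊔ Ideal.span {z} := by
    have hz' : z ∈ K ⊔ Ideal.span {z} := Ideal.mem_sup_right (Ideal.mem_span_singleton_self z)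
    refine sup_le (le_sup_left.trans le_sup_left) (Ideal.span_le.2 ?_)
    rintro w (rfl | rfl | rfl)
    · rw [show w = x' + α * z by simp [x']]
      exact add_mem (Ideal.mem_sup_left hx') (Ideal.mul_mem_left _ _ hz')
    · rw [show w = y' + β * z by simp [y']]
      exact add_mem (Ideal.mem_sup_left hy') (Ideal.mul_mem_left _ _ hz')
    · exact hz'
  obtain ⟨d, hd⟩ : ∃ d, 2 * e = d + 1 := ⟨2 * e - 1, by omega⟩
  set u := ∑ p, c p * (α ^ (p.1 : ℕ) * β ^ (p.2 : ℕ))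
  have hu : IsUnit u := by
    rw [← residue_ne_zero_iff_isUnit]
    simpa [u] using hαβ
  have hzd : z ^ (d + 1) ∈ K * J ^ d ⊔ maximalIdeal R * J ^ (d + 1) := by
    rw [← Ideal.unit_mul_mem_iff_mem _ hu]
    have hdiff : ∀ p : Fin e × Fin e,
        x ^ (p.1 : ℕ) * (y ^ (p.2 : ℕ) * z ^ (2 * e - p.1 - p.2)) -
          α ^ (p.1 : ℕ) * β ^ (p.2 : ℕ) * z ^ (d + 1) ∈ K * J ^ d := by
      intro p
      have h1 := p.1.2
      have h2 := p.2.2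
      have e1 := pow_mul_sub_mem (P := K) (d := d) hx hz hx' p.1 (p.2 + (2 * e - p.1 - p.2))
        (y ^ (p.2 : ℕ) * z ^ (2 * e - p.1 - p.2)) (by
          rw [pow_add]
          exact Ideal.mul_mem_mul (Ideal.pow_mem_pow hy _) (Ideal.pow_mem_pow hz _)) (by omega)
      have e2 := pow_mul_sub_mem (P := K) (d := d) hy hz hy' p.2 (p.1 + (2 * e - p.1 - p.2))
        (z ^ (p.1 + (2 * e - p.1 - p.2))) (Ideal.pow_mem_pow hz _) (by omega)
      have e3 := add_mem e1 (Ideal.mul_mem_left _ (α ^ (p.1 : ℕ)) e2)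
      have e4 : z ^ (d + 1) = z ^ (p.1 : ℕ) * z ^ (p.2 : ℕ) * z ^ (2 * e - p.1 - p.2) := by
        rw [← pow_add, ← pow_add]
        congr 1
        omega
      convert e3 using 1
      rw [e4, pow_add]
      ring
    have hsum : u * z ^ (d + 1) = -(∑ p : Fin e × Fin e, c p *
        (x ^ (p.1 : ℕ) * (y ^ (p.2 : ℕ) * z ^ (2 * e - p.1 - p.2)) -
          α ^ (p.1 : ℕ) * β ^ (p.2 : ℕ) * z ^ (d + 1))) +
        ∑ p : Fin e × Fin e, c p *
          (x ^ (p.1 : ℕ) * (y ^ (p.2 : ℕ) * z ^ (2 * e - p.1 - p.2))) := by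
      simp only [u, mul_sub, Finset.sum_sub_distrib, Finset.sum_mul]
      rw [neg_sub, sub_add_cancel]
      exact Finset.sum_congr rfl fun p _ => by ring
    rw [hsum, show J ^ (d + 1) = J ^ (2 * e) by rw [hd]]
    refine add_mem (Ideal.mem_sup_left (neg_mem (sum_mem fun p _ => ?_))) (Ideal.mem_sup_right hc)
    exact Ideal.mul_mem_left _ _ (hdiff p)
  refine ⟨x', y', hKJ, s + d, ?_⟩
  refine Submodule.le_of_le_smul_of_le_jacobson_bot (I := maximalIdeal R)
    (IsNoetherian.noetherian _) (jacobson_eq_maximalIdeal (R := R) ⊥ bot_ne_top).ge ?_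
  rw [smul_eq_mul]
  calc J ^ (s + d + 1) ≤ (K ⊔ Ideal.span {z}) ^ (d + 1) * J ^ s := by
        rw [add_assoc]
        exact (pow_add_le_pow_mul hs _).trans (Ideal.mul_mono_left (Ideal.pow_right_mono hKz _))
    _ ≤ (K * J ^ d ⊔ maximalIdeal R * J ^ (d + 1)) * J ^ s := by
        refine Ideal.mul_mono_left ((sup_span_singleton_pow_le hKJ hz d).trans ?_)
        exact sup_le le_sup_left ((Ideal.span_singleton_le_iff_mem _).2 hzd)
    _ = K * J ^ (s + d) ⊔ maximalIdeal R * J ^ (s + d + 1) := by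
        rw [Ideal.sup_mul, mul_assoc, mul_assoc, ← pow_add, ← pow_add, add_comm d s,
          show d + 1 + s = s + d + 1 by ring]

/-- An ideal with linear growth of the numbers of generators of its powers has a reduction generated
by two elements, if the residue field is infinite. -/
theorem exists_span_pair_reduction [Infinite (ResidueField R)] {J : Ideal R} {C : ℕ}
    (hC : ∀ d, (J ^ d).spanFinrank ≤ 1 + d * C) :
    ∃ x y, Ideal.span {x, y} ≤ J ∧ ∃ s, J ^ (s + 1) ≤ Ideal.span {x, y} * J ^ s := by
  classical
  have key : ∀ G : Finset R, ∀ x y, Ideal.span (G : Set R) ⊔ Ideal.span {x, y} ≤ J →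
      (∃ s, J ^ (s + 1) ≤ (Ideal.span (G : Set R) ⊔ Ideal.span {x, y}) * J ^ s) →
      ∃ x y, Ideal.span {x, y} ≤ J ∧ ∃ s, J ^ (s + 1) ≤ Ideal.span {x, y} * J ^ s := by
    intro G
    induction G using Finset.induction_on with
    | empty => intro x y h1 h2; exact ⟨x, y, by simpa using h1, by simpa using h2⟩
    | insert z G _ ih =>
      intro x y h1 h2
      have e : Ideal.span ((insert z G : Finset R) : Set R) ⊔ Ideal.span {x, y} =
          Ideal.span (G : Set R) ⊔ Ideal.span {x, y, z} := by
        rw [← Ideal.span_union, ← Ideal.span_union]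
        congr 1
        ext w
        simp
      rw [e] at h1 h2
      obtain ⟨x', y', h1, h2⟩ := exists_two_of_three hC h1 h2
      exact ih x' y' h1 h2
  obtain ⟨G, hG⟩ : J.FG := IsNoetherian.noetherian J
  have hG' : Ideal.span (G : Set R) ⊔ Ideal.span {0, 0} = J := by
    simpa using hG
  exact key G 0 0 hG'.le ⟨0, by rw [hG']; simp⟩

/-- Over an infinite residue field, a minimal reduction `J` is generated by two elements if some
`a ∈ J` and `b ∈ 𝔪` generate an ideal of finite colength. -/
theorem IsMinimalReduction.exists_eq_span_pair [Infinite (ResidueField R)] {𝓘 : ℤ → Ideal R}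
    {J : Ideal R} (hJ : IsMinimalReduction 𝓘 J) (hJl : ∀ n : ℕ, Module.length R (R ⧸ J ^ n) ≠ ⊤)
    {a b : R} (ha : a ∈ J) (hb : b ∈ maximalIdeal R)
    (hab : Module.length R (R ⧸ Ideal.span {b} ⊔ Ideal.span {a}) ≠ ⊤) :
    ∃ x y, J = Ideal.span {x, y} := by
  obtain ⟨C, hC⟩ := ENat.ne_top_iff_exists.1 hab
  obtain ⟨x, y, hxy, s, hs⟩ := exists_span_pair_reduction (J := J) (C := C) fun d => by
    have h1 := spanFinrank_le_one_add_length (Ideal.pow_mem_pow ha d) hb (hJl d)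
    have h2 := length_quotient_sup_span_pow_le (Ideal.span {b}) a d
    rw [← hC] at h2
    exact_mod_cast h1.trans (add_le_add_right h2 1)
  refine ⟨x, y, (hJ.eq_of_le ⟨hxy.trans hJ.prop.1, ?_⟩ hxy).symm⟩
  obtain ⟨n₀, hn₀⟩ := IsReduction.exists_pow_mul_eq hJ.prop
  filter_upwards [Filter.eventually_ge_atTop ((n₀ + s : ℕ) : ℤ)] with n hn
  have e0 := hn₀ (n - s) (by push_cast at hn; omega)
  have e1 := e0 s
  have e2 := e0 (s + 1)
  rw [sub_add_cancel] at e1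
  rw [Nat.cast_succ, ← add_assoc, sub_add_cancel] at e2
  refine le_antisymm ?_ ?_
  · have := hn₀ n (by push_cast at hn; omega) 1
    rw [pow_one, Nat.cast_one] at this
    exact this ▸ Ideal.mul_mono_left hxy
  · rw [← e1, ← e2, ← mul_assoc]
    exact Ideal.mul_mono_left hs

end NorthcottRees

/-! ### Hilbert coefficients and second differences -/

section Numerics

/-- A sequence that vanishes eventually is recovered from its second differences. -/
theorem eq_sum_of_second_difference (M : ℕ) (f w : ℕ → ℤ)
    (hw : ∀ k, f k - 2 * f (k + 1) + f (k + 2) = w k) (hf : ∀ k, M ≤ k → f k = 0) :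
    f 0 = ∑ k ∈ Finset.range M, ((k : ℤ) + 1) * w k ∧
      f 0 - f 1 = ∑ k ∈ Finset.range M, w k := by
  induction M generalizing f w with
  | zero => simp [hf]
  | succ M ih =>
    obtain ⟨h1, h2⟩ := ih (fun k => f (k + 1)) (fun k => w (k + 1)) (fun k => hw (k + 1))
      fun k hk => hf (k + 1) (by omega)
    have h0 := hw 0
    simp only [zero_add] at h0 h1 h2
    have e : ∑ k ∈ Finset.range M, (((k + 1 : ℕ) : ℤ) + 1) * w (k + 1) =
        f 1 + (f 1 - f (1 + 1)) := by
      rw [h2, h1, ← Finset.sum_add_distrib]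
      exact Finset.sum_congr rfl fun k _ => by push_cast; ring
    rw [Finset.sum_range_succ', Finset.sum_range_succ', e, ← h2]
    constructor
    · push_cast; linarith
    · linarith

theorem choose_add_two_two (n : ℤ) :
    Ring.choose (n + 2) 2 = Ring.choose (n + 1) 2 + (n + 1) := by
  have := Ring.choose_succ_succ (n + 1) 1
  rw [Ring.choose_one_right, add_assoc] at this
  rw [add_comm (Ring.choose _ _)]
  exact this

variable {R : Type*} [CommRing R]

theorem isHilbertCoeffs_two_iff {𝓘 : ℤ → Ideal R} {e : Fin 3 → ℤ} :
    IsHilbertCoeffs 2 𝓘 e ↔ ∀ᶠ n : ℤ in Filter.atTop,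
      colength (𝓘 n) = e 0 * Ring.choose (n + 1) 2 - e 1 * n + e 2 := by
  unfold IsHilbertCoeffs
  refine Filter.eventually_congr (Filter.Eventually.of_forall fun n => ?_)
  refine (Eq.congr_right (Fin.sum_univ_three _)).trans ?_
  have e1 : (n : ℤ) + (2 : ℕ) - 1 - ((0 : Fin 3) : ℕ) = n + 1 := by simp; ring
  have e2 : (n : ℤ) + (2 : ℕ) - 1 - ((1 : Fin 3) : ℕ) = n := by simp; ring
  rw [e1, e2]
  simp
  ring_nf

/-- The Hilbert coefficients exist and are unique if the second differences of the Hilbert function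
are eventually constant. -/
theorem existsUnique_isHilbertCoeffs {𝓘 : ℤ → Ideal R} {c : ℤ} (h : ∀ᶠ n : ℤ in Filter.atTop,
    colength (𝓘 (n + 2)) - 2 * colength (𝓘 (n + 1)) + colength (𝓘 n) = c) :
    ∃! e : Fin 3 → ℤ, IsHilbertCoeffs 2 𝓘 e := by
  obtain ⟨N, hN⟩ := Filter.eventually_atTop.1 h
  set q : ℤ → ℤ := fun n => Ring.choose (n + 1) 2
  have hq : ∀ n, q (n + 1) = q n + (n + 1) := fun n => by
    simp only [q]; rw [add_assoc]; exact choose_add_two_two n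
  have hq2 : ∀ n, q (n + 2) = q n + (n + 1) + (n + 2) := fun n => by
    have := hq (n + 1)
    rw [add_assoc n 1 1, one_add_one_eq_two, hq] at this
    linarith
  set l : ℤ → ℤ := fun n => colength (𝓘 n)
  set e₁ := c * (N + 1) - (l (N + 1) - l N) with he₁
  set e₂ := l N - c * q N + e₁ * N with he₂
  have hl : ∀ n, N ≤ n → l n = c * q n - e₁ * n + e₂ := by
    intro n hn
    obtain ⟨k, rfl⟩ : ∃ k : ℕ, n = N + k := ⟨(n - N).toNat, by omega⟩
    clear hn
    induction k using Nat.twoStepInduction with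
    | zero => simp [he₂]
    | one => push_cast; rw [hq, he₂, he₁]; ring
    | more k ih1 ih2 =>
      have h1 : l (N + k + 2) - 2 * l (N + k + 1) + l (N + k) = c := hN (N + k) (by omega)
      have e1 : N + ((k + 1 : ℕ) : ℤ) = N + k + 1 := by push_cast; ring
      have e2 : N + ((k + 2 : ℕ) : ℤ) = N + k + 2 := by push_cast; ring
      rw [e1, hq] at ih2
      rw [e2, hq2]
      linear_combination h1 + 2 * ih2 - ih1
  refine ⟨![c, e₁, e₂], isHilbertCoeffs_two_iff.2 (Filter.eventually_atTop.2 ⟨N, hl⟩),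
    fun e he => ?_⟩
  obtain ⟨N', hN'⟩ := Filter.eventually_atTop.1 (isHilbertCoeffs_two_iff.1 he)
  set n := max N N'
  have hd : ∀ k, n ≤ k → (e 0 - c) * q k - (e 1 - e₁) * k + (e 2 - e₂) = 0 := fun k hk => by
    have h1 : l k = e 0 * q k - e 1 * k + e 2 := hN' k ((le_max_right _ _).trans hk)
    have h2 := hl k ((le_max_left _ _).trans hk)
    linear_combination h2 - h1
  have d0 := hd n le_rfl
  have d1 := hd (n + 1) (by omega)
  have d2 := hd (n + 2) (by omega)
  rw [hq] at d1
  rw [hq2] at d2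
  have h0 : e 0 = c := by linear_combination d2 - 2 * d1 + d0
  have h1 : e 1 = e₁ := by linear_combination d0 - d1 + (n + 1) * h0
  have h2 : e 2 = e₂ := by linear_combination d0 - q n * h0 + n * h1
  ext i
  fin_cases i
  · exact h0
  · exact h1
  · exact h2

/-- If `h` is eventually the polynomial with coefficients `e`, and `u` is the defect of its second
differences from the constant `c`, then `e 2` and `e 1 - e 0 + h 1` are weighted sums of `u`. -/
theorem hilbertCoeffs_eq_sum {h u : ℤ → ℤ} {c : ℤ} {e : Fin 3 → ℤ} (h0 : h 0 = 0)
    (hu : ∀ n, h (n + 1) - 2 * h n + h (n - 1) = c - u n)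
    (hu0 : ∀ᶠ n : ℤ in Filter.atTop, u n = 0)
    (he : ∀ᶠ n : ℤ in Filter.atTop, h n = e 0 * Ring.choose (n + 1) 2 - e 1 * n + e 2) :
    ∃ M : ℕ, e 2 = ∑ k ∈ Finset.range M, ((k : ℤ) + 1) * u (k + 1) ∧
      e 1 - e 0 + h 1 = ∑ k ∈ Finset.range M, u (k + 1) ∧ ∀ k, M ≤ k → u ((k : ℤ) + 1) = 0 := by
  obtain ⟨N, hN⟩ := Filter.eventually_atTop.1 (hu0.and he)
  have hch := choose_add_two_two
  have hc : e 0 = c := by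
    obtain ⟨h1, h2⟩ := hN (N + 1) (by omega)
    have h3 := (hN (N + 1 + 1) (by omega)).2
    have h4 := (hN N le_rfl).2
    have h5 := hu (N + 1)
    rw [add_sub_cancel_right, h1, h2, h3, h4] at h5
    have e1 := hch N
    have e2 := hch (N + 1)
    rw [show N + 1 + 2 = N + 1 + 1 + 1 by ring] at e2
    rw [show N + 2 = N + 1 + 1 by ring] at e1
    rw [e2, e1] at h5
    linear_combination h5
  have hM : ∀ k : ℕ, N.toNat ≤ k → N ≤ k := fun k hk => by omega
  obtain ⟨h1, h2⟩ := eq_sum_of_second_difference N.toNat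
    (fun k => e 0 * Ring.choose ((k : ℤ) + 1) 2 - e 1 * k + e 2 - h k) (fun k => u (k + 1))
    (fun k => by
      have e1 := hch k
      have e2 := hch (k + 1)
      have h3 := hu (k + 1)
      rw [add_sub_cancel_right] at h3
      push_cast
      rw [show (k : ℤ) + 2 + 1 = k + 1 + 2 by ring, e2, show (k : ℤ) + 1 + 1 = k + 2 by ring, e1]
      rw [show (k : ℤ) + 1 + 1 = k + 2 by ring] at h3
      linear_combination hc - h3)
    fun k hk => sub_eq_zero.2 (hN k (hM k hk)).2.symm
  have q0 : Ring.choose (1 : ℤ) 2 = 0 := by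
    have := Ring.choose_natCast (R := ℤ) 1 2
    simpa using this
  have q1 : Ring.choose (2 : ℤ) 2 = 1 := by
    have := hch 0
    simpa [q0] using this
  refine ⟨N.toNat, ?_, ?_, fun k hk => (hN (k + 1) (by have := hM k hk; omega)).1⟩
  · rw [← h1]
    simp [q0, h0]
  · rw [← h2]
    simp [q0, q1, h0]
    ring

end Numerics

/-! ### Weighted sums of natural numbers -/

section Weights

variable {M E : ℕ} {w : ℕ → ℕ}

theorem weight_le (hw : ∀ k, M ≤ k → w k = 0) (hE : E = ∑ k ∈ Finset.range M, (k + 1) * w k)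
    {k : ℕ} : (k + 1) * w k ≤ E := by
  by_cases hk : k < M
  · rw [hE]
    exact Finset.single_le_sum (f := fun k => (k + 1) * w k) (fun _ _ => Nat.zero_le _)
      (Finset.mem_range.2 hk)
  · simp [hw k (by omega)]

theorem weight_add_le (hw : ∀ k, M ≤ k → w k = 0)
    (hE : E = ∑ k ∈ Finset.range M, (k + 1) * w k) {k l : ℕ} (hkl : k ≠ l) :
    (k + 1) * w k + (l + 1) * w l ≤ E := by
  by_cases hk : k < M
  · by_cases hl : l < M
    · rw [hE, ← Finset.sum_pair (f := fun k => (k + 1) * w k) hkl]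
      refine Finset.sum_le_sum_of_subset fun i hi => ?_
      rcases Finset.mem_insert.1 hi with rfl | hi
      · exact Finset.mem_range.2 hk
      · exact Finset.mem_singleton.1 hi ▸ Finset.mem_range.2 hl
    · simpa [hw l (by omega)] using weight_le hw hE
  · simpa [hw k (by omega)] using weight_le hw hE

/-- A nonzero weight in the top possible position exhausts the sum. -/
theorem weight_eq_of_top_ne_zero (hw : ∀ k, M ≤ k → w k = 0)
    (hE : E = ∑ k ∈ Finset.range M, (k + 1) * w k) {l : ℕ} (hl : l + 1 = E) (h : w l ≠ 0) :
    w l = 1 ∧ ∀ k, k ≠ l → w k = 0 := by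
  have h1 : (l + 1) * w l ≤ (l + 1) * 1 := by
    have := weight_le hw hE (k := l)
    omega
  have h2 : w l = 1 := by
    have := Nat.le_of_mul_le_mul_left h1 (by omega)
    omega
  refine ⟨h2, fun k hk => ?_⟩
  have := weight_add_le hw hE hk
  rw [h2] at this
  have h3 : (k + 1) * w k = 0 := by omega
  simpa using h3

theorem weight_eq_one_of_forall_ne (hE : E = ∑ k ∈ Finset.range M, (k + 1) * w k) {l : ℕ}
    (hl : l + 1 = E) (h : ∀ k, k ≠ l → w k = 0) : w l = 1 := by
  rw [Finset.sum_eq_single l (fun k _ hk => by simp [h k hk])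
    (fun hlM => by
      by_contra h0
      have : ∑ k ∈ Finset.range M, (k + 1) * w k = 0 :=
        Finset.sum_eq_zero fun k hk => by
          rw [h k fun hkl => hlM (hkl ▸ hk), mul_zero]
      omega)] at hE
  have : (l + 1) * w l = (l + 1) * 1 := by omega
  exact Nat.eq_of_mul_eq_mul_left (by omega) this

theorem exists_of_sum_weight_eq_one
    (hE : E = ∑ k ∈ Finset.range M, (k + 1) * w k) (hS : ∑ k ∈ Finset.range M, w k = 1) :
    ∃ l, l + 1 = E ∧ w l = 1 := by
  obtain ⟨l, hl, hl0⟩ : ∃ l ∈ Finset.range M, w l ≠ 0 := by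
    by_contra! h
    rw [Finset.sum_eq_zero h] at hS
    omega
  rw [← Finset.add_sum_erase _ _ hl] at hS
  have h0 : ∑ k ∈ (Finset.range M).erase l, w k = 0 := by omega
  have hz := Finset.sum_eq_zero_iff.1 h0
  have h1 : w l = 1 := by omega
  refine ⟨l, ?_, h1⟩
  rw [hE, ← Finset.add_sum_erase _ _ hl, h1, Finset.sum_eq_zero fun k hk => by simp [hz k hk]]
  simp

theorem sum_weight_eq_one (hw : ∀ k, M ≤ k → w k = 0) {l : ℕ} (h1 : w l = 1)
    (h : ∀ k, k ≠ l → w k = 0) : ∑ k ∈ Finset.range M, w k = 1 := by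
  rw [Finset.sum_eq_single l (fun k _ hk => h k hk) (fun hlM => by
    simpa [h1] using hw l (by simpa using hlM))]
  exact h1

end Weights

/-! ### Huneke's fundamental lemma -/

section HunekeFormula

variable {R : Type*} [CommRing R]

theorem colength_cast {𝔞 : Ideal R} (h : Module.length R (R ⧸ 𝔞) ≠ ⊤) :
    ∃ m : ℕ, Module.length R (R ⧸ 𝔞) = m ∧ colength 𝔞 = m :=
  ⟨_, (ENat.natCast_toNat h).symm, rfl⟩

/-- Huneke's fundamental lemma for three consecutive terms `𝔟 ⊆ 𝔞 ⊆ 𝔠` of a filtration, of which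
only `𝔠 = 𝔞 : (x, y)` and `(x, y)𝔞 ⊆ 𝔟` are used. -/
theorem colength_second_difference {x y : R}
    (hxy : ∀ r s, r * x + s * y = 0 → ∃ t, r = t * y ∧ s = -(t * x))
    {𝔞 𝔟 𝔠 : Ideal R} (h𝔠 : ∀ r, r ∈ 𝔠 ↔ r * x ∈ 𝔞 ∧ r * y ∈ 𝔞)
    (h𝔟 : Ideal.span {x, y} * 𝔞 ≤ 𝔟)
    (hJ : Module.length R (R ⧸ Ideal.span {x, y}) ≠ ⊤) (ha : Module.length R (R ⧸ 𝔞) ≠ ⊤) :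
    ∃ m : ℕ, relLength 𝔟 (Ideal.span {x, y} * 𝔞) = m ∧
      colength 𝔟 - 2 * colength 𝔞 + colength 𝔠 = colength (Ideal.span {x, y}) - m := by
  -- Both `h2` and `h3` compute `λ(R/(x, y)𝔞)`; all lengths are then seen to be finite, so that the
  -- equations can be read in `ℕ`.
  have h1 := length_koszul hxy h𝔠
  have h2 := length_quotient_eq_relLength_add
    (Ideal.mul_le_left : Ideal.span {x, y} * 𝔞 ≤ Ideal.span {x, y})
  have h3 := length_quotient_eq_relLength_add h𝔟
  obtain ⟨a, ha, ha'⟩ := colength_cast ha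
  obtain ⟨j, hj, hj'⟩ := colength_cast hJ
  rw [ha] at h1
  have h1top : Module.length R (R ⧸ 𝔠) +
      relLength (Ideal.span {x, y}) (Ideal.span {x, y} * 𝔞) ≠ ⊤ := by
    rw [← h1]
    exact_mod_cast ENat.natCast_ne_top (2 * a)
  rw [ne_eq, ENat.add_eq_top, not_or] at h1top
  obtain ⟨c, hc, hc'⟩ := colength_cast h1top.1
  obtain ⟨p, hp⟩ := ENat.ne_top_iff_exists.1 h1top.2
  rw [hc, ← hp] at h1
  rw [h3, ← hp, hj] at h2
  have h2top : relLength 𝔟 (Ideal.span {x, y} * 𝔞) + Module.length R (R ⧸ 𝔟) ≠ ⊤ := by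
    rw [h2]
    exact_mod_cast ENat.natCast_ne_top (p + j)
  rw [ne_eq, ENat.add_eq_top, not_or] at h2top
  obtain ⟨b, hb, hb'⟩ := colength_cast h2top.2
  obtain ⟨m, hm⟩ := ENat.ne_top_iff_exists.1 h2top.1
  rw [← hm, hb] at h2
  refine ⟨m, hm.symm, ?_⟩
  have h1 : 2 * a = c + p := by exact_mod_cast h1
  have h2 : m + b = p + j := by exact_mod_cast h2
  rw [ha', hb', hc', hj']
  omega

theorem IsHilbertCoeffs.hilbertCoeff_spec {d : ℕ} {𝓘 : ℤ → Ideal R}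
    (h : ∃ e, IsHilbertCoeffs d 𝓘 e) : IsHilbertCoeffs d 𝓘 (hilbertCoeff d 𝓘) := by
  rw [hilbertCoeff, dif_pos h]
  exact h.choose_spec

theorem relLength_eq_zero_iff_eq {𝔞 𝔟 : Ideal R} (h : 𝔞 ≤ 𝔟) : relLength 𝔟 𝔞 = 0 ↔ 𝔟 = 𝔞 :=
  relLength_eq_zero_iff.trans ⟨fun h' => le_antisymm h' h, fun h' => h'.le⟩

end HunekeFormula

end FiltrationHilbert

/-! ### The bound on the reduction number -/

open FiltrationHilbert in
theorem mainTheorem5 {R : Type*} [CommRing R] [IsLocalRing R]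
    (hCM : FiltrationHilbert.IsCohenMacaulayLocal R) (hdim : ringKrullDim R = 2)
    (I : Ideal R) (hI : I.radical = IsLocalRing.maximalIdeal R)
    (𝓘 : ℤ → Ideal R) (h𝓘 : FiltrationHilbert.IsAdmissible I 𝓘)
    (J : Ideal R) (hJ : FiltrationHilbert.IsMinimalReduction 𝓘 J) (hJI : J ≤ I)
    (hJ2 : Infinite (IsLocalRing.ResidueField R) ∨ ∃ x y : R, J = Ideal.span {x, y})
    (e₀ e₁ e₂ : ℤ) (he₀ : e₀ = FiltrationHilbert.hilbertCoeff 2 𝓘 0)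
    (he₁ : e₁ = FiltrationHilbert.hilbertCoeff 2 𝓘 1)
    (he₂ : e₂ = FiltrationHilbert.hilbertCoeff 2 𝓘 2)
    (T : ℤ → Ideal R) (hT : T = FiltrationHilbert.ratliffRush I 𝓘)
    (r : ℤ) (hr : r = FiltrationHilbert.rTilde I J 𝓘) :
    -- the Hilbert coefficients and the supremum are well defined
    (∃! e : Fin 3 → ℤ, FiltrationHilbert.IsHilbertCoeffs 2 𝓘 e) ∧
    (FiltrationHilbert.rTildeSet I J 𝓘).Nonempty ∧
    BddAbove (FiltrationHilbert.rTildeSet I J 𝓘) ∧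
    -- the bound
    r ≤ e₂ + 1 ∧
    -- (iv) implies (iii)
    (e₁ = e₀ - FiltrationHilbert.colength (T 1) + 1 →
      FiltrationHilbert.relLength (T (e₂ + 1)) (J * T e₂) = 1) ∧
    -- (iii) implies (i)
    (FiltrationHilbert.relLength (T (e₂ + 1)) (J * T e₂) = 1 → r = e₂ + 1) ∧
    -- (i) implies (ii)
    (r = e₂ + 1 → ∀ n : ℕ, n ≠ 0 → (n : ℤ) ≠ e₂ → T (n + 1) = J * T n) ∧
    -- (ii) implies (i)
    (J ≠ I → (∀ n : ℕ, n ≠ 0 → (n : ℤ) ≠ e₂ → T (n + 1) = J * T n) → r = e₂ + 1) ∧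
    -- all four are equivalent if `e₂ ≠ 0`
    (e₂ ≠ 0 → List.TFAE [
      r = e₂ + 1,
      ∀ n : ℕ, n ≠ 0 → (n : ℤ) ≠ e₂ → T (n + 1) = J * T n,
      FiltrationHilbert.relLength (T (e₂ + 1)) (J * T e₂) = 1,
      e₁ = e₀ - FiltrationHilbert.colength (T 1) + 1]) := by

  obtain ⟨a₀, ha₀, b₀, hb₀, hreg₀, hlen₀⟩ := hCM.exists_isRegularPair hdim
  have hN : IsNoetherianRing R := hCM.1
  have hJred : IsReduction 𝓘 J := hJ.prop
  -- `J` is `𝔪`-primary and contains powers of the regular sequence `a₀, b₀`.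
  have hIm : I ≤ IsLocalRing.maximalIdeal R := hI ▸ Ideal.le_radical
  have hJrad : J.radical = IsLocalRing.maximalIdeal R := by
    refine le_antisymm (hI ▸ Ideal.radical_mono hJI) ?_
    obtain ⟨n₀, hn₀⟩ := hJred.exists_pow_mul_eq
    have h1 : I ^ (n₀ + 1) ≤ J := by
      have h2 := h𝓘.pow_le ((n₀ + 1 : ℕ) : ℤ)
      rw [Int.toNat_natCast] at h2
      refine h2.trans ?_
      have h3 := hn₀ n₀ le_rfl 1
      push_cast at h3 ⊢
      rw [← h3, pow_one]
      exact Ideal.mul_le_left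
    rw [← hI, ← Ideal.radical_pow I (Nat.succ_ne_zero n₀)]
    exact Ideal.radical_mono h1
  obtain ⟨i, hai⟩ : ∃ i, a₀ ^ i ∈ J := hJrad.ge ha₀
  obtain ⟨j, hbj⟩ : ∃ j, b₀ ^ j ∈ J := hJrad.ge hb₀
  have hJm : J ≤ IsLocalRing.maximalIdeal R := hJI.trans hIm
  have hJl := length_quotient_pow_ne_top hJrad
  obtain ⟨x, y, hxy⟩ : ∃ x y, J = Ideal.span {x, y} := by
    rcases hJ2 with hk | h
    · refine hJ.exists_eq_span_pair hJl hai hb₀ ?_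
      refine ne_top_of_le_ne_top ?_ (length_quotient_sup_span_pow_le (Ideal.span {b₀}) a₀ i)
      obtain ⟨m, hm⟩ := ENat.ne_top_iff_exists.1 hlen₀
      rw [← hm]
      exact_mod_cast ENat.natCast_ne_top (i * m)
    · exact h
  have hreg := hreg₀.pow i j
  have hkos := hreg.exists_koszul (hxy ▸ hai) (hxy ▸ hbj)
    (hJm (hxy ▸ Ideal.subset_span (by simp)))
  have hTl : ∀ n, Module.length R (R ⧸ T n) ≠ ⊤ := fun n => by
    rw [hT]
    exact ne_top_of_le_ne_top (length_quotient_pow_ne_top hI n.toNat)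
      (length_quotient_mono ((h𝓘.pow_le n).trans (le_ratliffRush n)))
  have hmul : ∀ n, J * T n ≤ T (n + 1) := fun n => by
    rw [hT]; exact mul_ratliffRush_le h𝓘 hJI n
  have hcolon : ∀ n r, r ∈ T (n - 1) ↔ r * x ∈ T n ∧ r * y ∈ T n := by
    intro n r
    constructor
    · intro hr
      have h1 := hmul (n - 1)
      rw [sub_add_cancel] at h1
      rw [mul_comm r, mul_comm r]
      exact ⟨h1 (Ideal.mul_mem_mul (hxy ▸ Ideal.subset_span (by simp)) hr),
        h1 (Ideal.mul_mem_mul (hxy ▸ Ideal.subset_span (by simp)) hr)⟩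
    · rintro ⟨h1, h2⟩
      rw [hT] at h1 h2 ⊢
      exact mem_ratliffRush_of_forall_mul_mem h𝓘 hJred hJI hxy (by simpa using h1)
        (by simpa using h2)
  have hT0 : ∀ n ≤ 0, T n = ⊤ := fun n hn => by
    rw [hT]; exact ratliffRush_of_nonpos h𝓘 hn
  obtain ⟨n₁, hn₁⟩ := ratliffRush_eventually_eq h𝓘 hJred hJI hai hreg.1
  rw [← hT] at hn₁
  -- `u n` is the length of `Ĩ_{n+1}/JĨ_n`.
  have hu : ∀ n : ℤ, ∃ m : ℕ, relLength (T (n + 1)) (J * T n) = m ∧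
      colength (T (n + 1)) - 2 * colength (T n) + colength (T (n - 1)) = colength J - m := by
    intro n
    rw [hxy]
    exact colength_second_difference hkos (hcolon n) (hxy ▸ hmul n)
      (by have := hJl 1; rwa [pow_one, hxy] at this) (hTl n)
  choose u hu hu2 using hu
  have hu0 : ∀ n, u n = 0 ↔ T (n + 1) = J * T n := fun n => by
    rw [← relLength_eq_zero_iff_eq (hmul n), hu, Nat.cast_eq_zero]
  have hu0' : ∀ᶠ n : ℤ in Filter.atTop, u n = 0 := by
    filter_upwards [hJred.2, Filter.eventually_ge_atTop (n₁ : ℤ)] with n h1 h2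
    rw [hu0, hn₁ n h2, hn₁ (n + 1) (by omega), h1]
  have hTev : ∀ᶠ n : ℤ in Filter.atTop, colength (𝓘 n) = colength (T n) := by
    filter_upwards [Filter.eventually_ge_atTop (n₁ : ℤ)] with n h2
    rw [hn₁ n h2]
  have hex : ∃! e : Fin 3 → ℤ, IsHilbertCoeffs 2 𝓘 e := by
    refine existsUnique_isHilbertCoeffs (c := colength J) ?_
    obtain ⟨N, hN⟩ := Filter.eventually_atTop.1 (hTev.and hu0')
    filter_upwards [Filter.eventually_ge_atTop N] with n hn
    have h1 := hu2 (n + 1)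
    rw [(hN (n + 1) (by omega)).2, add_sub_cancel_right, add_assoc, one_add_one_eq_two] at h1
    rw [(hN n hn).1, (hN (n + 1) (by omega)).1, (hN (n + 2) (by omega)).1, h1]
    simp
  have hcoef := isHilbertCoeffs_two_iff.1 (IsHilbertCoeffs.hilbertCoeff_spec hex.exists)
  have h00 : colength (T 0) = 0 := by
    rw [hT0 0 le_rfl]
    have : Subsingleton (R ⧸ (⊤ : Ideal R)) := Ideal.Quotient.subsingleton_iff.2 rfl
    simp [colength]
  obtain ⟨M, hM1, hM2, hM3⟩ := hilbertCoeffs_eq_sum (h := fun n => colength (T n))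
    (u := fun n => (u n : ℤ)) (c := colength J) h00 hu2
    (by filter_upwards [hu0'] with n hn; simp [hn])
    (by filter_upwards [hcoef, hTev] with n h1 h2; rw [← h2, h1])
  rw [← he₂] at hM1
  rw [← he₁, ← he₀] at hM2
  -- From here on only the weights `w k = λ(Ĩ_{k+2}/JĨ_{k+1})` matter.
  set w : ℕ → ℕ := fun k => u (k + 1)
  have hw : ∀ k, M ≤ k → w k = 0 := fun k hk => by exact_mod_cast hM3 k hk
  obtain ⟨E, hE⟩ : ∃ E : ℕ, E = ∑ k ∈ Finset.range M, (k + 1) * w k := ⟨_, rfl⟩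
  have heE : e₂ = E := by rw [hM1, hE]; push_cast; rfl
  have hS : e₁ - e₀ + colength (T 1) = ((∑ k ∈ Finset.range M, w k : ℕ) : ℤ) := by
    rw [hM2]; push_cast; rfl
  -- The assertions of the theorem in terms of `r̃`, `E` and `w`, where `E = e₂` and `u E = w (E - 1)`
  -- unless `E = 0`.
  have hiv : e₁ = e₀ - colength (T 1) + 1 ↔ ∑ k ∈ Finset.range M, w k = 1 := by
    rw [← Nat.cast_inj (R := ℤ), ← hS]
    constructor <;> intro h <;> push_cast at * <;> linarith
  have hset : ∀ n, n ∈ rTildeSet I J 𝓘 ↔ u (n - 1) ≠ 0 := fun n => by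
    rw [ne_eq, hu0, sub_add_cancel, hT]
    rfl
  have hmem0 : (0 : ℤ) ∈ rTildeSet I J 𝓘 := by
    rw [hset, ne_eq, hu0, hT0 _ (by norm_num), hT0 _ (by norm_num), Ideal.mul_top]
    exact fun h => (IsLocalRing.maximalIdeal.isMaximal R).ne_top (top_le_iff.1 (h.trans_le hJm))
  have hwset : ∀ k : ℕ, ((k : ℤ) + 2) ∈ rTildeSet I J 𝓘 ↔ w k ≠ 0 := fun k => by
    rw [hset, show (k : ℤ) + 2 - 1 = k + 1 by ring]
  have hbd : ∀ n ∈ rTildeSet I J 𝓘, n ≤ e₂ + 1 := by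
    intro n hn
    rcases le_or_gt n 1 with h | h
    · omega
    · obtain ⟨k, rfl⟩ : ∃ k : ℕ, n = k + 2 := ⟨(n - 2).toNat, by omega⟩
      have h1 := (hwset k).1 hn
      have h2 := weight_le hw hE (k := k)
      have h3 : k + 1 ≤ E := (Nat.le_mul_of_pos_right _ (Nat.pos_of_ne_zero h1)).trans h2
      omega
  have hne : (rTildeSet I J 𝓘).Nonempty := ⟨0, hmem0⟩
  have hbdd : BddAbove (rTildeSet I J 𝓘) := ⟨e₂ + 1, hbd⟩
  have hrmem : r ∈ rTildeSet I J 𝓘 := hr ▸ Int.csSup_mem hne hbdd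
  have hrle : ∀ n ∈ rTildeSet I J 𝓘, n ≤ r := fun n hn => hr ▸ le_csSup hbdd hn
  have hi : r = e₂ + 1 ↔ u E ≠ 0 := by
    rw [← add_sub_cancel_right (E : ℤ) 1, ← hset, ← heE]
    exact ⟨fun h => h ▸ hrmem, fun h => le_antisymm (hbd _ hrmem) (hrle _ h)⟩
  have hii : (∀ n : ℕ, n ≠ 0 → (n : ℤ) ≠ e₂ → T (n + 1) = J * T n) ↔
      ∀ k, k + 1 ≠ E → w k = 0 := by
    constructor
    · intro h k hk
      have := h (k + 1) k.succ_ne_zero (by omega)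
      rw [← hu0] at this
      exact_mod_cast this
    · intro h n hn hnE
      obtain ⟨k, rfl⟩ := Nat.exists_eq_succ_of_ne_zero hn
      rw [← hu0]
      have := h k (by omega)
      exact_mod_cast this
  have hiii : relLength (T (e₂ + 1)) (J * T e₂) = 1 ↔ u E = 1 := by
    rw [hu, heE, Nat.cast_eq_one]
  have huE : ∀ l, l + 1 = E → u E = w l := fun l hl => by
    simp only [w]; rw [← hl]; push_cast; rfl
  have h43 : e₁ = e₀ - colength (T 1) + 1 → relLength (T (e₂ + 1)) (J * T e₂) = 1 := by
    rw [hiv, hiii]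
    intro h
    obtain ⟨l, hl, hl1⟩ := exists_of_sum_weight_eq_one hE h
    rw [huE l hl, hl1]
  have h31 : relLength (T (e₂ + 1)) (J * T e₂) = 1 → r = e₂ + 1 := by
    rw [hiii, hi]
    intro h
    omega
  have h12 : r = e₂ + 1 → ∀ n : ℕ, n ≠ 0 → (n : ℤ) ≠ e₂ → T (n + 1) = J * T n := by
    rw [hi, hii]
    intro h k hk
    rcases Nat.eq_zero_or_pos E with h0 | h0
    · have := weight_le hw hE (k := k)
      rw [h0] at this
      simpa using this
    · obtain ⟨l, hl⟩ : ∃ l, l + 1 = E := ⟨E - 1, by omega⟩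
      rw [huE l hl] at h
      exact (weight_eq_of_top_ne_zero hw hE hl h).2 k (by omega)
  have h24 : e₂ ≠ 0 → (∀ n : ℕ, n ≠ 0 → (n : ℤ) ≠ e₂ → T (n + 1) = J * T n) →
      e₁ = e₀ - colength (T 1) + 1 := by
    rw [hii, hiv]
    intro h0 h
    obtain ⟨l, hl⟩ : ∃ l, l + 1 = E := ⟨E - 1, by omega⟩
    have h' : ∀ k, k ≠ l → w k = 0 := fun k hk => h k (by omega)
    exact sum_weight_eq_one hw (weight_eq_one_of_forall_ne hE hl h') h'
  refine ⟨hex, hne, hbdd, hbd r hrmem, h43, h31, h12, ?_, ?_⟩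
  · intro hJI' h
    by_cases h0 : e₂ = 0
    · -- All `w k` vanish, and `T 1 = J * T 0` would force `I ≤ 𝓘 1 ≤ T 1 = J`.
      rw [hi, ne_eq, hu0]
      have hE0 : (E : ℤ) = 0 := heE ▸ h0
      rw [hE0, hT0 0 le_rfl, Ideal.mul_top, zero_add]
      intro h1
      refine hJI' (le_antisymm hJI (h1 ▸ ?_))
      rw [hT]
      exact h𝓘.le_one.trans (le_ratliffRush 1)
    · exact h31 (h43 (h24 h0 h))
  · intro h0
    tfae_have 1 → 2 := h12
    tfae_have 2 → 4 := h24 h0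
    tfae_have 4 → 3 := h43
    tfae_have 3 → 1 := h31
    tfae_finish
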